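/- Let $n\ge 2$, let $J=(J_{ij})$ be a skew-symmetric real $n\times n$ matrix, write $e(t)=e^{2\pi i t}$, $\bar e(t)=e^{-2\pi i t}$, and let $\beta$ be the ordinary inner product on $\mathbb R^n$. Let $G=\mathbb R^n\times\mathbb R^n\times\mathbb R$ be the group with the law $$(p,q,r)(p',q',r')=\Bigl(p+p',\;q+q'+r'\sum_{i,j}J_{ij}p_i\mathbf q_j,\;r+r'\Bigr).$$ Let $\mathcal H=L^2(\mathbb R^n\times\mathbb R^n\times\mathbb R)$, in the variables $(x,y,r)$, with Lebesgue measure, and put $V_\Theta=V\Theta$ on $\mathcal H\otimes\mathcal H=L^2(\{(x,y,r;x',y',r')\})$. Here $V=(Z_{12}X_{24}Z_{12}^*)Y_{13}$ is the unitary operator built (in leg notation, the legs being $(x,y),r,(x',y'),r'$) from $$X\xi(r;r')=\xi(r+r';r'),\quad Y\xi(x,y;x',y')=\xi(x,y;x'-x,y'-y),\quad Z\xi(x,y;r)=\xi\Bigl(x+r\sum_{i,j}J_{ij}y_j\mathbf x_i,y;r\Bigr),$$ and $\Theta$ is multiplication by $\bar e[r'\beta(x,y')]\,\bar e[\tfrac{r'^2}{2}\sum_{i,j}J_{ij}y_jy'_i]$.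 Let $S\subseteq\mathcal B(\mathcal H)$ be the norm closure of the slices $(\omega\otimes\mathrm{id})(V_\Theta)$, $\omega\in\mathcal B(\mathcal H)_*$, and let $\Delta(a)=V_\Theta(a\otimes 1)V_\Theta^*$ for $a\in\mathcal B(\mathcal H)$, in particular for $a\in S$. Let $$\sigma^r\bigl((x,y),(x',y')\bigr)=\bar e\Bigl[\tfrac{r^2}{2}\sum_{i,j}J_{ij}y_jy'_i\Bigr]\bar e[r\beta(x,y')].$$ For $\phi\in C_c(G)$ let $\phi^\vee(x,y,r)=\int\phi(p,q,r)\,e[p\cdot x+q\cdot y]\,dp\,dq$ and $$L_\phi\zeta(x,y,r)=\int\phi^\vee(\tilde x,\tilde y,r)\,\sigma^r\bigl((\tilde x,\tilde y),(x-\tilde x,y-\tilde y)\bigr)\,\zeta(x-\tilde x,y-\tilde y,r)\,d\tilde x\,d\tilde y .$$ For a bounded continuous function $F$ on $G\times G$ and $\zeta\in C_c^\infty$ on the space of points $(x,y,r;x',y',r')$ let $$(L\otimes L)_F\,\zeta(x,y,r;x',y',r')=\int F(p,q,r;p',q',r')\Bigl[\int e[p\cdot\tilde x+q\cdot\tilde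 y+p'\cdot\tilde x'+q'\cdot\tilde y']\,\sigma^r\bigl((\tilde x,\tilde y),(x-\tilde x,y-\tilde y)\bigr)\,\sigma^{r'}\bigl((\tilde x',\tilde y'),(x'-\tilde x',y'-\tilde y')\bigr)\,\zeta(x-\tilde x,y-\tilde y,r;x'-\tilde x',y'-\tilde y',r')\,d\tilde x\,d\tilde y\,d\tilde x'\,d\tilde y'\Bigr]dp\,dq\,dp'\,dq';$$ a bounded operator on $\mathcal H\otimes\mathcal H$ is called $(L\otimes L)_F$ if it is given by this formula on $C_c^\infty$. Then: (1) For every $\phi\in C_c^\infty(G)$ the integral defining $L_\phi\zeta$ ($\zeta\in\mathcal H$) converges absolutely almost everywhere and $L_\phi$ is a bounded operator on $\mathcal H$. Moreover $S$ is the norm closure of $\{L_\phi:\phi\in C_c^\infty(G)\}$. (2) For every $\phi\in C_c(G)$ the function $\Delta(\phi)$ on $G\times G$ defined by $$\bigl(\Delta(\phi)\bigr)(p,q,r;p',q',r')=\phi\bigl((p,q,r)(p',q',r')\bigr)=\phi\Bigl(p+p',q+q'+r'\sum_{i,j}J_{ij}p_i\mathbf q_j,r+r'\Bigr)$$ is bounded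 and continuous, and $\Delta(L_\phi)=(L\otimes L)_{\Delta(\phi)}$ in the following sense. (a) If $L_\phi$ is bounded (in particular, by (1), if $\phi\in C_c^\infty(G)$), then $\Delta(L_\phi)=V_\Theta(L_\phi\otimes1)V_\Theta^*$ is the unique bounded operator $(L\otimes L)_{\Delta(\phi)}$. (b) For every $\phi\in C_c(G)$, whether or not $L_\phi$ is bounded, and every $\zeta\in C_c^\infty$, the function $(L_\phi\otimes1)V_\Theta^*\zeta$ ($L_\phi$ acting by its integral formula in the first three variables) is defined by an integral that converges absolutely almost everywhere and belongs to $\mathcal H\otimes\mathcal H$, and $$V_\Theta(L_\phi\otimes1)V_\Theta^*\zeta=(L\otimes L)_{\Delta(\phi)}\zeta ,$$ where the outer integral on the right converges absolutely almost everywhere. -/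

import Mathlib

open MeasureTheory
open scoped TensorProduct ContDiff

noncomputable section

namespace HeisenbergQG

/-- The Hilbert space `L²(α)` of complex-valued functions. -/
abbrev L2 (α : Type) [MeasureSpace α] : Type := Lp ℂ 2 (volume : Measure α)

/- ### The Hilbert space tensor product `L²(α) ⊗ L²(α) = L²(α × α)` -/

theorem memLp_tmul {α : Type} [MeasureSpace α] [SigmaFinite (volume : Measure α)] (f g : L2 α) :
    MemLp (fun z : α × α => f z.1 * g z.2) 2 := by
  have hm : AEStronglyMeasurable (fun z : α × α => f z.1 * g z.2) :=
    (Lp.aestronglyMeasurable f).comp_fst.mul (Lp.aestronglyMeasurable g).comp_snd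
  rw [memLp_two_iff_integrable_sq_norm hm]
  have h1 := (memLp_two_iff_integrable_sq_norm (Lp.aestronglyMeasurable f)).1 (Lp.memLp f)
  have h2 := (memLp_two_iff_integrable_sq_norm (Lp.aestronglyMeasurable g)).1 (Lp.memLp g)
  simpa [mul_pow] using! h1.mul_prod h2

/-- The function `f ⊗ g : (u, u') ↦ f u * g u'`, as an element of `L²(α × α)`. -/
def tmul {α : Type} [MeasureSpace α] [SigmaFinite (volume : Measure α)] (f g : L2 α) :
    L2 (α × α) := (memLp_tmul f g).toLp

theorem coeFn_tmul {α : Type} [MeasureSpace α] [SigmaFinite (volume : Measure α)] (f g : L2 α) :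
    tmul f g =ᵐ[volume] fun z : α × α => f z.1 * g z.2 := MemLp.coeFn_toLp _

theorem ae_fst {α : Type} [MeasureSpace α] [SigmaFinite (volume : Measure α)] {p : α → Prop}
    (h : ∀ᵐ a, p a) : ∀ᵐ z : α × α, p z.1 := Measure.quasiMeasurePreserving_fst.ae h

theorem ae_snd {α : Type} [MeasureSpace α] [SigmaFinite (volume : Measure α)] {p : α → Prop}
    (h : ∀ᵐ a, p a) : ∀ᵐ z : α × α, p z.2 := Measure.quasiMeasurePreserving_snd.ae h

/-- The bilinear map `(f, g) ↦ f ⊗ g`. -/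
def tmulₗ (α : Type) [MeasureSpace α] [SigmaFinite (volume : Measure α)] :
    L2 α →ₗ[ℂ] L2 α →ₗ[ℂ] L2 (α × α) :=
  LinearMap.mk₂ ℂ tmul
    (fun f f' g => by
      apply Lp.ext
      filter_upwards [coeFn_tmul (f + f') g, coeFn_tmul f g, coeFn_tmul f' g,
        Lp.coeFn_add (tmul f g) (tmul f' g), ae_fst (Lp.coeFn_add f f')] with z h1 h2 h3 h4 h5
      rw [h4, h1, h5, Pi.add_apply, Pi.add_apply, h2, h3, add_mul])
    (fun c f g => by
      apply Lp.ext
      filter_upwards [coeFn_tmul (c • f) g, coeFn_tmul f g,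
        Lp.coeFn_smul c (tmul f g), ae_fst (Lp.coeFn_smul c f)] with z h1 h2 h4 h5
      simp [h1, h2, h4, h5, mul_assoc])
    (fun f g g' => by
      apply Lp.ext
      filter_upwards [coeFn_tmul f (g + g'), coeFn_tmul f g, coeFn_tmul f g',
        Lp.coeFn_add (tmul f g) (tmul f g'), ae_snd (Lp.coeFn_add g g')] with z h1 h2 h3 h4 h5
      rw [h4, h1, h5, Pi.add_apply, Pi.add_apply, h2, h3, mul_add])
    (fun c f g => by
      apply Lp.ext
      filter_upwards [coeFn_tmul f (c • g), coeFn_tmul f g,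
        Lp.coeFn_smul c (tmul f g), ae_snd (Lp.coeFn_smul c g)] with z h1 h2 h4 h5
      simp [h1, h2, h4, h5, mul_left_comm])

theorem inner_tmul {α : Type} [MeasureSpace α] [SigmaFinite (volume : Measure α)]
    (f g f' g' : L2 α) :
    inner ℂ (tmul f g) (tmul f' g') = inner ℂ f f' * inner ℂ g g' := by
  simp only [L2.inner_def]
  rw [← integral_prod_mul]
  apply integral_congr_ae
  filter_upwards [coeFn_tmul f g, coeFn_tmul f' g'] with z h1 h2
  simp only [h1, h2, RCLike.inner_apply, map_mul]
  ring

/-- The linear map `L²(α) ⊗ L²(α) → L²(α × α)` on the algebraic tensor product. -/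
def tensorToL2 (α : Type) [MeasureSpace α] [SigmaFinite (volume : Measure α)] :
    L2 α ⊗[ℂ] L2 α →ₗ[ℂ] L2 (α × α) := TensorProduct.lift (tmulₗ α)

theorem tensorToL2_tmul {α : Type} [MeasureSpace α] [SigmaFinite (volume : Measure α)]
    (f g : L2 α) : tensorToL2 α (f ⊗ₜ g) = tmul f g := rfl

theorem inner_tensorToL2 {α : Type} [MeasureSpace α] [SigmaFinite (volume : Measure α)]
    (s t : L2 α ⊗[ℂ] L2 α) : inner ℂ (tensorToL2 α s) (tensorToL2 α t) = inner ℂ s t := by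
  induction s with
  | zero => simp
  | add a b ha hb => simp [inner_add_left, ha, hb]
  | tmul f g =>
    induction t with
    | zero => simp
    | add a b ha hb => simp [inner_add_right, ha, hb]
    | tmul f' g' => simp [tensorToL2_tmul, inner_tmul]

theorem norm_tensorToL2 {α : Type} [MeasureSpace α] [SigmaFinite (volume : Measure α)]
    (t : L2 α ⊗[ℂ] L2 α) : ‖tensorToL2 α t‖ = ‖t‖ := by
  rw [@norm_eq_sqrt_re_inner ℂ, @norm_eq_sqrt_re_inner ℂ, inner_tensorToL2]

theorem norm_rTensor_le {E : Type} [NormedAddCommGroup E] [InnerProductSpace ℂ E]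
    (T : E →L[ℂ] E) (t : E ⊗[ℂ] E) :
    ‖TensorProduct.map T.toLinearMap LinearMap.id t‖ ≤ ‖T‖ * ‖t‖ := by
  classical
  obtain ⟨E', F', iE', iF', hz⟩ :=
    TensorProduct.exists_finite_submodule_of_setFinite {t} (Set.finite_singleton t)
  obtain ⟨y, rfl⟩ := Set.singleton_subset_iff.mp hz
  let f := stdOrthonormalBasis ℂ F'
  obtain ⟨h, rfl⟩ : ∃ h : _ → E', y = ∑ i, h i ⊗ₜ f i := by
    induction y with
    | zero => exact ⟨0, by simp⟩
    | add a b ha hb =>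
      obtain ⟨h1, e1⟩ := ha (by simp)
      obtain ⟨h2, e2⟩ := hb (by simp)
      exact ⟨h1 + h2, by rw [e1, e2]; simp [TensorProduct.add_tmul, Finset.sum_add_distrib]⟩
    | tmul a b =>
      refine ⟨fun i => f.repr b i • a, ?_⟩
      conv_lhs => rw [← f.sum_repr b, TensorProduct.tmul_sum]
      simp [TensorProduct.smul_tmul]
  have key : ∀ k : Fin (Module.finrank ℂ F') → E,
      ‖∑ i, k i ⊗ₜ[ℂ] (f i : E)‖ ^ 2 = ∑ i, ‖k i‖ ^ 2 := by
    intro k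
    have hf : ∀ i j, inner ℂ (f i : E) (f j : E) = if i = j then 1 else 0 := by
      intro i j
      rw [← Submodule.coe_inner, f.inner_eq_ite]
    have h2 : (inner ℂ (∑ i, k i ⊗ₜ[ℂ] (f i : E)) (∑ i, k i ⊗ₜ[ℂ] (f i : E)) : ℂ)
        = ∑ i, inner ℂ (k i) (k i) := by
      simp [sum_inner, inner_sum, hf]
    rw [@norm_sq_eq_re_inner ℂ]
    refine (congrArg RCLike.re h2).trans ?_
    rw [map_sum]
    exact Finset.sum_congr rfl fun i _ => (norm_sq_eq_re_inner (𝕜 := ℂ) (k i)).symm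
  have e1 : TensorProduct.map T.toLinearMap LinearMap.id
      (TensorProduct.mapIncl E' F' (∑ i, h i ⊗ₜ f i)) = ∑ i, T (h i) ⊗ₜ[ℂ] (f i : E) := by
    simp [TensorProduct.mapIncl]
  have e2 : TensorProduct.mapIncl E' F' (∑ i, h i ⊗ₜ f i) = ∑ i, (h i : E) ⊗ₜ[ℂ] (f i : E) := by
    simp [TensorProduct.mapIncl]
  rw [e1, e2]
  apply le_of_sq_le_sq _ (by positivity)
  rw [mul_pow, key, key, Finset.mul_sum]
  gcongr with i
  rw [← mul_pow]
  gcongr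
  exact T.le_opNorm _

theorem denseRange_tensorToL2 (α : Type) [MeasureSpace α] [SigmaFinite (volume : Measure α)] :
    DenseRange (tensorToL2 α) := by
  have h : (LinearMap.range (tensorToL2 α)).topologicalClosure = ⊤ := by
    rw [Submodule.topologicalClosure_eq_top_iff, Submodule.eq_bot_iff]
    intro k hk
    rw [Submodule.mem_orthogonal] at hk
    have hrect : ∀ s t : Set α, MeasurableSet s → MeasurableSet t → volume s ≠ ⊤ →
        volume t ≠ ⊤ → ∫ z in s ×ˢ t, k z = 0 := by
      intro s t hs ht hs' ht'
      have := hk (tmul (indicatorConstLp 2 hs hs' 1) (indicatorConstLp 2 ht ht' 1))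
        ⟨_ ⊗ₜ _, tensorToL2_tmul _ _⟩
      rw [L2.inner_def] at this
      rw [← this, ← integral_indicator (hs.prod ht)]
      apply integral_congr_ae
      filter_upwards [coeFn_tmul (indicatorConstLp 2 hs hs' (1:ℂ)) (indicatorConstLp 2 ht ht' 1),
        ae_fst (indicatorConstLp_coeFn (p := 2) (hs := hs) (hμs := hs') (c := (1:ℂ))),
        ae_snd (indicatorConstLp_coeFn (p := 2) (hs := ht) (hμs := ht') (c := (1:ℂ)))]
        with z h1 h2 h3
      rw [h1, h2, h3]
      by_cases a1 : z.1 ∈ s <;> by_cases a2 : z.2 ∈ t <;>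
        simp [Set.indicator, Set.mem_prod, a1, a2]
    let S := spanningSets (volume : Measure α)
    have hS : ∀ i, MeasurableSet (S i) := measurableSet_spanningSets _
    have hSf : ∀ i, volume (S i) ≠ ⊤ := fun i => (measure_spanningSets_lt_top _ i).ne
    have hint : ∀ i, IntegrableOn k (S i ×ˢ S i) := by
      intro i
      have : IsFiniteMeasure (volume.restrict (S i ×ˢ S i)) := by
        refine ⟨?_⟩
        rw [Measure.restrict_apply_univ, Measure.volume_eq_prod, Measure.prod_prod]
        exact ENNReal.mul_lt_top (hSf i).lt_top (hSf i).lt_top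
      exact (Lp.memLp k).restrict _ |>.integrable (by norm_num)
    have hall : ∀ i, ∀ u : Set (α × α), MeasurableSet u → ∫ z in u ∩ S i ×ˢ S i, k z = 0 := by
      intro i
      refine MeasurableSpace.induction_on_inter generateFrom_prod.symm isPiSystem_prod ?_ ?_ ?_ ?_
      · simp
      · rintro _ ⟨s, hs, t, ht, rfl⟩
        rw [Set.prod_inter_prod]
        exact hrect _ _ (hs.inter (hS i)) (ht.inter (hS i))
          (measure_ne_top_of_subset Set.inter_subset_right (hSf i))
          (measure_ne_top_of_subset Set.inter_subset_right (hSf i))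
      · intro u hu h0
        have := integral_inter_add_sdiff (μ := volume) hu (hint i)
        rw [Set.inter_comm, h0, zero_add, hrect _ _ (hS i) (hS i) (hSf i) (hSf i)] at this
        rwa [Set.inter_comm, ← Set.sdiff_eq]
      · intro f hd hf h0
        rw [Set.iUnion_inter]
        rw [integral_iUnion (fun j => (hf j).inter ((hS i).prod (hS i)))
          (fun a b hab => (hd hab).mono Set.inter_subset_left Set.inter_subset_left)
          ((hint i).mono_set (by simp))]
        simp [h0]
    have h0 : ∀ i, ∀ᵐ z ∂(volume.restrict (S i ×ˢ S i)), k z = 0 := by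
      intro i
      refine Integrable.ae_eq_zero_of_forall_setIntegral_eq_zero (hint i) ?_
      intro u hu _
      rw [Measure.restrict_restrict hu]
      exact hall i u hu
    have hU : (⋃ i, S i ×ˢ S i) = (Set.univ : Set (α × α)) := by
      rw [Set.iUnion_eq_univ_iff]
      intro z
      obtain ⟨i, hi⟩ := Set.mem_iUnion.1 ((iUnion_spanningSets (volume : Measure α)).symm ▸
        Set.mem_univ z.1 : z.1 ∈ ⋃ i, S i)
      obtain ⟨j, hj⟩ := Set.mem_iUnion.1 ((iUnion_spanningSets (volume : Measure α)).symm ▸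
        Set.mem_univ z.2 : z.2 ∈ ⋃ i, S i)
      exact ⟨max i j, monotone_spanningSets _ (le_max_left i j) hi,
        monotone_spanningSets _ (le_max_right i j) hj⟩
    rw [Lp.eq_zero_iff_ae_eq_zero]
    have := (ae_restrict_iUnion_iff (μ := volume) (fun i => S i ×ˢ S i) (fun z => k z = 0)).2 h0
    rwa [hU, Measure.restrict_univ] at this
  rw [DenseRange, ← LinearMap.coe_range, dense_iff_closure_eq, ← Submodule.topologicalClosure_coe, h]
  rfl

/-- The operator `T ⊗ 1` on `L²(α × α) = L²(α) ⊗ L²(α)`, the bounded extension of the algebraic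
tensor product of `T` and the identity. -/
def ampl {α : Type} [MeasureSpace α] [SigmaFinite (volume : Measure α)] (T : L2 α →L[ℂ] L2 α) :
    L2 (α × α) →L[ℂ] L2 (α × α) :=
  ((tensorToL2 α).comp (TensorProduct.map T.toLinearMap LinearMap.id)).extendOfNorm (tensorToL2 α)

theorem ampl_tmul {α : Type} [MeasureSpace α] [SigmaFinite (volume : Measure α)]
    (T : L2 α →L[ℂ] L2 α) (f g : L2 α) : ampl T (tmul f g) = tmul (T f) g := by
  rw [← tensorToL2_tmul, ampl, LinearMap.extendOfNorm_eq (denseRange_tensorToL2 α)]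
  · rfl
  · exact ⟨‖T‖, fun t => by simpa [norm_tensorToL2] using norm_rTensor_le T t⟩

theorem norm_tmul {α : Type} [MeasureSpace α] [SigmaFinite (volume : Measure α)] (f g : L2 α) :
    ‖tmul f g‖ = ‖f‖ * ‖g‖ := by
  rw [← tensorToL2_tmul, norm_tensorToL2, TensorProduct.norm_tmul]

/-- The bounded operator `g ↦ f ⊗ g`. -/
def tmulLeft {α : Type} [MeasureSpace α] [SigmaFinite (volume : Measure α)] (f : L2 α) :
    L2 α →L[ℂ] L2 (α × α) :=
  (tmulₗ α f).mkContinuous ‖f‖ fun g => (norm_tmul f g).le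

/-- The slice `(ω_{ξ,η} ⊗ id)(W)`, where `ω_{ξ,η}(T) = ⟨T ξ, η⟩` (linear in `ξ`): it sends `ζ` to the
vector representing `χ ↦ ⟨W (ξ ⊗ ζ), η ⊗ χ⟩`. -/
def slice {α : Type} [MeasureSpace α] [SigmaFinite (volume : Measure α)] (ξ η : L2 α)
    (W : L2 (α × α) →L[ℂ] L2 (α × α)) : L2 α →L[ℂ] L2 α :=
  (ContinuousLinearMap.adjoint (tmulLeft η)).comp (W.comp (tmulLeft ξ))

/-- The unitary operator `ξ ↦ ξ ∘ m`, for a measure preserving bijection `m`. -/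
def compU {β : Type} [MeasureSpace β] (m : β ≃ᵐ β) (hm : MeasurePreserving m) :
    L2 β ≃ₗᵢ[ℂ] L2 β :=
  LinearIsometryEquiv.ofSurjective (Lp.compMeasurePreservingₗᵢ ℂ m hm) (by
    intro f
    refine ⟨Lp.compMeasurePreserving m.symm (hm.symm m) f, ?_⟩
    apply Lp.ext
    have h := hm.quasiMeasurePreserving.ae
      (Lp.coeFn_compMeasurePreserving f (hm.symm m))
    filter_upwards [Lp.coeFn_compMeasurePreserving
      (Lp.compMeasurePreserving m.symm (hm.symm m) f) hm, h] with z h1 h2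
    have h3 : Lp.compMeasurePreservingₗᵢ ℂ m hm
      (Lp.compMeasurePreserving m.symm (hm.symm m) f) =
        Lp.compMeasurePreserving m hm (Lp.compMeasurePreserving m.symm (hm.symm m) f) := rfl
    rw [h3, h1]
    simpa using! h2)

theorem coeFn_compU {β : Type} [MeasureSpace β] (m : β ≃ᵐ β) (hm : MeasurePreserving m)
    (f : L2 β) : compU m hm f =ᵐ[volume] fun z => f (m z) :=
  Lp.coeFn_compMeasurePreserving f hm

theorem memLp_mulU {β : Type} [MeasureSpace β] {θ : β → Circle}
    (hθ : Measurable fun z => (θ z : ℂ)) (f : L2 β) :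
    MemLp (fun z => (θ z : ℂ) * f z) 2 := by
  refine (Lp.memLp f).of_le ?_ (Filter.Eventually.of_forall fun z => by simp [Circle.norm_coe])
  exact hθ.aestronglyMeasurable.mul (Lp.aestronglyMeasurable f)

theorem memLp_mulU_inv {β : Type} [MeasureSpace β] {θ : β → Circle}
    (hθ : Measurable fun z => (θ z : ℂ)) (f : L2 β) :
    MemLp (fun z => (θ z : ℂ)⁻¹ * f z) 2 := by
  refine (Lp.memLp f).of_le ?_ (Filter.Eventually.of_forall fun z => by simp [Circle.norm_coe])
  exact hθ.inv.aestronglyMeasurable.mul (Lp.aestronglyMeasurable f)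

/-- Multiplication by the unimodular function `θ`, as a unitary operator. -/
def mulU {β : Type} [MeasureSpace β] (θ : β → Circle) (hθ : Measurable fun z => (θ z : ℂ)) :
    L2 β ≃ₗᵢ[ℂ] L2 β where
  toFun f := (memLp_mulU hθ f).toLp
  invFun f := (memLp_mulU_inv hθ f).toLp
  map_add' f g := by
    rw [← MemLp.toLp_add]
    apply MemLp.toLp_congr
    filter_upwards [Lp.coeFn_add f g] with z h
    rw [h, Pi.add_apply, Pi.add_apply, mul_add]
  map_smul' c f := by
    rw [RingHom.id_apply, ← MemLp.toLp_const_smul]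
    apply MemLp.toLp_congr
    filter_upwards [Lp.coeFn_smul c f] with z h
    rw [h, Pi.smul_apply, Pi.smul_apply, smul_eq_mul, smul_eq_mul, mul_left_comm]
  left_inv f := by
    apply Lp.ext
    filter_upwards [(memLp_mulU_inv hθ (memLp_mulU hθ f).toLp).coeFn_toLp,
      (memLp_mulU hθ f).coeFn_toLp] with z h1 h2
    rw [h1, h2, inv_mul_cancel_left₀ (Circle.coe_ne_zero _)]
  right_inv f := by
    apply Lp.ext
    filter_upwards [(memLp_mulU hθ (memLp_mulU_inv hθ f).toLp).coeFn_toLp,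
      (memLp_mulU_inv hθ f).coeFn_toLp] with z h1 h2
    rw [h1, h2, mul_inv_cancel_left₀ (Circle.coe_ne_zero _)]
  norm_map' f := by
    change ‖(memLp_mulU hθ f).toLp‖ = ‖f‖
    rw [Lp.norm_def, Lp.norm_def]
    congr 1
    refine (eLpNorm_congr_ae (memLp_mulU hθ f).coeFn_toLp).trans ?_
    exact eLpNorm_congr_norm_ae (Filter.Eventually.of_forall fun z => by simp [Circle.norm_coe])

theorem coeFn_mulU {β : Type} [MeasureSpace β] {θ : β → Circle}
    (hθ : Measurable fun z => (θ z : ℂ)) (f : L2 β) :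
    mulU θ hθ f =ᵐ[volume] fun z => (θ z : ℂ) * f z := (memLp_mulU hθ f).coeFn_toLp

/- ### Shear maps -/

/-- The shear `(a, b) ↦ (a + f b, b)`. -/
def shearL {A B : Type} [MeasurableSpace A] [AddGroup A] [MeasurableAdd₂ A] [MeasurableNeg A]
    [MeasurableSpace B] (f : B → A) (hf : Measurable f) : A × B ≃ᵐ A × B where
  toFun z := (z.1 + f z.2, z.2)
  invFun z := (z.1 + -f z.2, z.2)
  left_inv z := by simp
  right_inv z := by simp
  measurable_toFun := by dsimp; fun_prop
  measurable_invFun := by dsimp; fun_prop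

/-- The shear `(b, a) ↦ (b, a + f b)`. -/
def shearR {A B : Type} [MeasurableSpace A] [AddGroup A] [MeasurableAdd₂ A] [MeasurableNeg A]
    [MeasurableSpace B] (f : B → A) (hf : Measurable f) : B × A ≃ᵐ B × A where
  toFun z := (z.1, z.2 + f z.1)
  invFun z := (z.1, z.2 + -f z.1)
  left_inv z := by simp
  right_inv z := by simp
  measurable_toFun := by dsimp; fun_prop
  measurable_invFun := by dsimp; fun_prop

theorem shearR_mp {A B : Type} [MeasureSpace A] [AddGroup A] [MeasurableAdd₂ A] [MeasurableNeg A]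
    [MeasureSpace B] [SFinite (volume : Measure A)] [SFinite (volume : Measure B)]
    [(volume : Measure A).IsAddRightInvariant] (f : B → A) (hf : Measurable f) :
    MeasurePreserving (shearR f hf) := by
  refine (MeasurePreserving.id (volume : Measure B)).skew_product
    (g := fun b a => a + f b) (μc := (volume : Measure A)) (μd := (volume : Measure A)) ?_ ?_
  · exact measurable_snd.add (hf.comp measurable_fst)
  · exact Filter.Eventually.of_forall fun b => map_add_right_eq_self _ _

theorem shearL_mp {A B : Type} [MeasureSpace A] [AddGroup A] [MeasurableAdd₂ A] [MeasurableNeg A]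
    [MeasureSpace B] [SFinite (volume : Measure A)] [SFinite (volume : Measure B)]
    [(volume : Measure A).IsAddRightInvariant] (f : B → A) (hf : Measurable f) :
    MeasurePreserving (shearL f hf) :=
  (Measure.measurePreserving_swap.comp (shearR_mp f hf)).comp Measure.measurePreserving_swap

/- ### The multiplicative unitary operator -/

/-- Vectors in `ℝⁿ`; the inner product `β(x, y)` is the dot product `x ⬝ᵥ y`. -/
abbrev V (n : ℕ) : Type := Fin n → ℝ

/-- The space of triples, in the variables `(x, y, r)` (that is, `H/Z × G₁`) as well as in the
variables `(p, q, r)` (that is, `G`), with Lebesgue measure. -/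
abbrev X (n : ℕ) : Type := V n × V n × ℝ

instance (n : ℕ) : (volume : Measure (X n)).IsAddRightInvariant :=
  have : (volume : Measure (V n × ℝ)).IsAddLeftInvariant :=
    inferInstanceAs (((volume : Measure (V n)).prod (volume : Measure ℝ)).IsAddLeftInvariant)
  have : (volume : Measure (X n)).IsAddLeftInvariant :=
    inferInstanceAs (((volume : Measure (V n)).prod
      (volume : Measure (V n × ℝ))).IsAddLeftInvariant)
  inferInstance

/-- `Z₁₂`, where `Zξ(x, y, r) = ξ(x + r ∑ J_ij y_j x_i, y, r)`. -/
def opZ₁₂ {n : ℕ} (J : Matrix (Fin n) (Fin n) ℝ) : L2 (X n × X n) ≃ₗᵢ[ℂ] L2 (X n × X n) :=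
  compU ((shearL (fun v : V n × ℝ => v.2 • J.mulVec v.1) (by fun_prop)).prodCongr
      (MeasurableEquiv.refl (X n)))
    ((shearL_mp _ _).prod (MeasurePreserving.id _))

/-- `X₂₄`, where `Xξ(r, r') = ξ(r + r', r')`. -/
def opX₂₄ (n : ℕ) : L2 (X n × X n) ≃ₗᵢ[ℂ] L2 (X n × X n) :=
  compU (shearL (fun u' : X n => ((0, 0, u'.2.2) : X n)) (by fun_prop)) (shearL_mp _ _)

/-- `Y₁₃`, where `Yξ(x, y, x', y') = ξ(x, y, x' - x, y' - y)`. -/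
def opY₁₃ (n : ℕ) : L2 (X n × X n) ≃ₗᵢ[ℂ] L2 (X n × X n) :=
  compU (shearR (fun u : X n => ((-u.1, -u.2.1, 0) : X n)) (by fun_prop)) (shearR_mp _ _)

/-- `Θ(x, y, r; x', y', r') = ē[r' β(x, y')] ē[(r'² / 2) ∑ J_ij y_j y'_i]`, where
`e(t) = exp(2πit)`. -/
def Theta {n : ℕ} (J : Matrix (Fin n) (Fin n) ℝ) (z : X n × X n) : Circle :=
  Real.fourierChar (-(z.2.2.2 * (z.1.1 ⬝ᵥ z.2.2.1))) *
    Real.fourierChar (-(z.2.2.2 ^ 2 / 2 * (J.mulVec z.1.2.1 ⬝ᵥ z.2.2.1)))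

theorem measurable_Theta {n : ℕ} (J : Matrix (Fin n) (Fin n) ℝ) :
    Measurable fun z => (Theta J z : ℂ) := by
  apply Continuous.measurable
  unfold Theta
  have := Real.continuous_fourierChar
  fun_prop

/-- `V_Θ = V Θ` with `V = (Z₁₂ X₂₄ Z₁₂*) Y₁₃`, a unitary operator on `L²(H/Z × G₁ × H/Z × G₁)`. -/
def VTheta {n : ℕ} (J : Matrix (Fin n) (Fin n) ℝ) : L2 (X n × X n) ≃ₗᵢ[ℂ] L2 (X n × X n) :=
  (opZ₁₂ J * opX₂₄ n * (opZ₁₂ J)⁻¹) * opY₁₃ n * mulU (Theta J) (measurable_Theta J)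

/-- The algebra `S`: the norm closure of the slices `(ω ⊗ id)(V_Θ)`, where `ω` runs through the
finite linear combinations of the `ω_{ξ,η}` (which are dense in the predual of `B(ℋ)`). -/
def algS {n : ℕ} (J : Matrix (Fin n) (Fin n) ℝ) : Submodule ℂ (L2 (X n) →L[ℂ] L2 (X n)) :=
  (Submodule.span ℂ {T | ∃ ξ η : L2 (X n),
    T = slice ξ η ((VTheta J).toContinuousLinearEquiv : _ →L[ℂ] _)}).topologicalClosure

/-- The comultiplication `Δ(T) = V_Θ (T ⊗ 1) V_Θ*`. -/
def comul {n : ℕ} (J : Matrix (Fin n) (Fin n) ℝ) (T : L2 (X n) →L[ℂ] L2 (X n)) :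
    L2 (X n × X n) →L[ℂ] L2 (X n × X n) :=
  ((VTheta J).toContinuousLinearEquiv : L2 (X n × X n) →L[ℂ] L2 (X n × X n)).comp
    ((ampl T).comp ((VTheta J).symm.toContinuousLinearEquiv : L2 (X n × X n) →L[ℂ] L2 (X n × X n)))

/- ### The group `G` and the regular representation -/

/-- The group law `(p,q,r)(p',q',r') = (p + p', q + q' + r' ∑ J_ij p_i q_j, r + r')` of `G`. -/
def gmul {n : ℕ} (J : Matrix (Fin n) (Fin n) ℝ) (g g' : X n) : X n :=
  (g.1 + g'.1, g.2.1 + g'.2.1 + g'.2.2 • Matrix.vecMul g.1 J, g.2.2 + g'.2.2)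

/-- `Δ(φ)`: the function `(g, g') ↦ φ(g g')` on `G × G`. -/
def comulFun {n : ℕ} (J : Matrix (Fin n) (Fin n) ℝ) (φ : X n → ℂ) (z : X n × X n) : ℂ :=
  φ (gmul J z.1 z.2)

/-- The cocycle `σ^r((x, y), (x', y')) = ē[(r² / 2) ∑ J_ij y_j y'_i] ē[r β(x, y')]`. -/
def sigma {n : ℕ} (J : Matrix (Fin n) (Fin n) ℝ) (r : ℝ) (w w' : V n × V n) : Circle :=
  Real.fourierChar (-(r ^ 2 / 2 * (J.mulVec w.2 ⬝ᵥ w'.2))) * Real.fourierChar (-(r * (w.1 ⬝ᵥ w'.2)))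

/-- The character `e[p·x + q·y]`, for `k = (p, q)` and `w = (x, y)`. -/
def pairing {n : ℕ} (k w : V n × V n) : Circle := Real.fourierChar (k.1 ⬝ᵥ w.1 + k.2 ⬝ᵥ w.2)

/-- The partial Fourier transform `φ^∨(x, y, r) = ∫ φ(p, q, r) e[p·x + q·y] dp dq`, `w = (x, y)`. -/
def pft {n : ℕ} (φ : X n → ℂ) (w : V n × V n) (r : ℝ) : ℂ :=
  ∫ k : V n × V n, φ (k.1, k.2, r) * pairing k w

/-- The integrand `φ^∨(x̃, ỹ, r) σ^r((x̃, ỹ), (x - x̃, y - ỹ)) ζ(x - x̃, y - ỹ, r)` in the formula for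
`L_φ ζ` at the point `u = (x, y, r)`; here `w = (x̃, ỹ)`. -/
def regIntegrand {n : ℕ} (J : Matrix (Fin n) (Fin n) ℝ) (φ : X n → ℂ) (ζ : X n → ℂ) (u : X n)
    (w : V n × V n) : ℂ :=
  pft φ w u.2.2 * sigma J u.2.2 w (u.1 - w.1, u.2.1 - w.2) * ζ (u.1 - w.1, u.2.1 - w.2, u.2.2)

/-- `T` is the bounded operator `L_φ` on `ℋ = L²(H/Z × G₁)`. -/
def IsReg {n : ℕ} (J : Matrix (Fin n) (Fin n) ℝ) (φ : X n → ℂ) (T : L2 (X n) →L[ℂ] L2 (X n)) :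
    Prop :=
  ∀ ζ : L2 (X n), ∀ᵐ u : X n, Integrable (regIntegrand J φ ζ u) ∧
    T ζ u = ∫ w, regIntegrand J φ ζ u w

/-- `η = (L_φ ⊗ 1) κ`, where `L_φ`, given by its integral formula and possibly unbounded, acts in the
first variable `u` of `κ(u, u')`. -/
def IsRegAmp {n : ℕ} (J : Matrix (Fin n) (Fin n) ℝ) (φ : X n → ℂ) (κ η : L2 (X n × X n)) : Prop :=
  ∀ᵐ z : X n × X n, Integrable (regIntegrand J φ (fun v => κ (v, z.2)) z.1) ∧
    η z = ∫ w, regIntegrand J φ (fun v => κ (v, z.2)) z.1 w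

/-- `∫ e[p·x̃ + q·ỹ] e[p'·x̃' + q'·ỹ'] σ^r((x̃, ỹ), (x - x̃, y - ỹ)) σ^r'((x̃', ỹ'), (x' - x̃', y' - ỹ'))
ζ(x - x̃, y - ỹ, r; x' - x̃', y' - ỹ', r') dx̃ dỹ dx̃' dỹ'`, for `z = (x, y, r; x', y', r')` and
`k = (p, q; p', q')`. -/
def regTensorKernel {n : ℕ} (J : Matrix (Fin n) (Fin n) ℝ) (ζ : X n × X n → ℂ) (z : X n × X n)
    (k : (V n × V n) × (V n × V n)) : ℂ :=
  ∫ w : (V n × V n) × (V n × V n), pairing k.1 w.1 * pairing k.2 w.2 *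
    sigma J z.1.2.2 w.1 (z.1.1 - w.1.1, z.1.2.1 - w.1.2) *
    sigma J z.2.2.2 w.2 (z.2.1 - w.2.1, z.2.2.1 - w.2.2) *
    ζ ((z.1.1 - w.1.1, z.1.2.1 - w.1.2, z.1.2.2), (z.2.1 - w.2.1, z.2.2.1 - w.2.2, z.2.2.2))

/-- `η = (L ⊗ L)_F ζ` for a bounded function `F` on `G × G` and a test function `ζ`. For `F` with
compact support, Fubini's theorem turns the right side into the formula for `L` on both legs, namely
`∫ F^∨(x̃, ỹ, r; x̃', ỹ', r') σ^r(..) σ^r'(..) ζ(x - x̃, y - ỹ, r; x' - x̃', y' - ỹ', r')`. For bounded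
`F`, where `F^∨` is only a distribution, the integral over the `(p, q; p', q')` variables is taken
last. -/
def IsRegTensorAt {n : ℕ} (J : Matrix (Fin n) (Fin n) ℝ) (F : X n × X n → ℂ) (ζ : X n × X n → ℂ)
    (η : L2 (X n × X n)) : Prop :=
  ∀ᵐ z : X n × X n,
    Integrable (fun k : (V n × V n) × (V n × V n) =>
      F ((k.1.1, k.1.2, z.1.2.2), (k.2.1, k.2.2, z.2.2.2)) * regTensorKernel J ζ z k) ∧
    η z = ∫ k : (V n × V n) × (V n × V n),
      F ((k.1.1, k.1.2, z.1.2.2), (k.2.1, k.2.2, z.2.2.2)) * regTensorKernel J ζ z k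

/-- `B` is the bounded operator `(L ⊗ L)_F` on `ℋ ⊗ ℋ`; it is determined by its values on the dense
subspace of test functions. -/
def IsRegTensor {n : ℕ} (J : Matrix (Fin n) (Fin n) ℝ) (F : X n × X n → ℂ)
    (B : L2 (X n × X n) →L[ℂ] L2 (X n × X n)) : Prop :=
  ∀ ζ : X n × X n → ℂ, ContDiff ℝ ∞ ζ → HasCompactSupport ζ →
    ∀ κ : L2 (X n × X n), κ =ᵐ[volume] ζ → IsRegTensorAt J F ζ (B κ)

end HeisenbergQG

end

open HeisenbergQG

/-!
Three observations carry the proof.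

*The unitary is a weighted composition operator.* `V_Θ` is `κ ↦ Θ(m z) κ(m z)` for an explicit measure
preserving bijection `m` (`mapV`, `coeFn_VTheta`), so that everything can be computed at points. The
operator `L_φ` is twisted convolution, fibre by fibre in `r`, with the symbol `φ^∨(x, y, r)`; more
generally `IsTw J f T` says that `T` is twisted convolution with the symbol `f`. By the Schur test
(`exists_isTw`) such an operator is bounded by `sup_r ‖f(·, r)‖₁`, and for a test function `φ` this
supremum is finite because `φ^∨` is recovered from the full Fourier transform of `φ`, an integrable
function, by inversion in the variable dual to `r` (`exists_integrable_bound_pft`).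

*The algebra `S`.* For continuous `ξ, η` of compact support, the slice of `V_Θ` at `ω_{ξ,η}` is twisted
convolution with the symbol `∫ conj (η(x + r' J y, y, r)) ξ(x, y, r + r') dr`, a continuous function of
`(x, y, r')` with compact support (`isTw_slice`). It remains to compare three classes of symbols in the
norm `sup_r ‖·‖₁`: partial transforms `φ^∨` of test functions, continuous functions of compact support,
and slices.
- A test function is a limit of partial transforms (`exists_lintegral_symb_sub_pft_le`). A Fourier
  transform in `r` turns the supremum over `r` into an `L¹` norm in all variables, and the Fourier
  transforms of test functions are dense in `L¹` (`exists_lintegral_sub_fourierInv_le`).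
- A partial transform is a limit of its truncations, which are continuous of compact support
  (`IsReg.mem_algS`).
- A continuous function of compact support is a limit of slices, where `η` is an approximate identity in
  the variable `r` (`IsTw.mem_algS`).

*The comultiplication.* Because `J` is skew-symmetric, conjugation by `V_Θ` turns the cocycle `σ^{r + r'}`
into the product of `σ^r` and `σ^{r'}` along the graph of the shear `(x, y) ↦ (x + r' J y, y)`
(`Theta_mul_sigma_mul_inv`). Hence `V_Θ (L_φ ⊗ 1) V_Θ* ζ` at a point is the integral of `φ^∨(·, r + r')`
against the restriction of a test function to this graph. On the side of the frequencies, restriction to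
the graph is integration along the dual fibres, over which `Δ(φ)` is constant; this is Fourier inversion
in half of the variables (`integral_mul_ft_coordWW`) and gives `(L ⊗ L)_{Δ(φ)} ζ`. When `L_φ` is not known
to be bounded, `(L_φ ⊗ 1) V_Θ* ζ` is square integrable because the fibres of `φ^∨` are in `L²` by
Plancherel's theorem, and the convolution of a function in `L²` with one in `L¹` is in `L²`
(`memLp_integral_twInt_pair`). When `L_φ` is bounded, its integral formula, applied in the first variable,
represents `L_φ ⊗ 1` (`eq_ampl_of_ae_slice`), and uniqueness holds since test functions are dense.
-/

noncomputable section

namespace HeisenbergQG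

open scoped FourierTransform NNReal

/-! ### Fourier analysis on Euclidean spaces -/

section InnerProduct

variable {H : Type} [NormedAddCommGroup H] [InnerProductSpace ℝ H] [FiniteDimensional ℝ H]
  [MeasurableSpace H] [BorelSpace H]

theorem fourierInv_coe_toSchwartzMap {φ : H → ℂ} (hc : HasCompactSupport φ) (hs : ContDiff ℝ ∞ φ) :
    ((𝓕⁻ (hc.toSchwartzMap hs) : SchwartzMap H ℂ) : H → ℂ) = 𝓕⁻ φ := by
  rw [SchwartzMap.fourierInv_coe]; rfl

theorem memLp_fourierInv {φ : H → ℂ} (hc : HasCompactSupport φ) (hs : ContDiff ℝ ∞ φ)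
    (p : ENNReal) : MemLp (𝓕⁻ φ) p volume := by
  rw [← fourierInv_coe_toSchwartzMap hc hs]
  exact SchwartzMap.memLp _ _ _

/-- By Plancherel's theorem, the Fourier transforms of test functions are dense in `L²`. -/
theorem exists_eLpNorm_sub_fourierInv_le {h : H → ℂ} (hh : MemLp h 2 volume) {ε : ℝ}
    (hε : 0 < ε) : ∃ φ : H → ℂ, HasCompactSupport φ ∧ ContDiff ℝ ∞ φ ∧
      eLpNorm (h - 𝓕⁻ φ) 2 volume ≤ ENNReal.ofReal ε := by
  obtain ⟨φ, hc, hs, hφ⟩ := MemLp.exist_eLpNorm_sub_le (p := 2) (by simp) (by norm_num)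
    (Lp.memLp (𝓕 hh.toLp : Lp ℂ 2 (volume : Measure H))) hε
  refine ⟨φ, hc, hs, ?_⟩
  set s := hc.toSchwartzMap hs
  have e1 : ‖hh.toLp - (𝓕⁻ s).toLp 2 volume‖ =
      ‖(𝓕 hh.toLp : Lp ℂ 2 (volume : Measure H)) - s.toLp 2 volume‖ := by
    have := (Lp.fourierTransformₗᵢ H ℂ).map_sub hh.toLp ((𝓕⁻ s).toLp 2 volume)
    rw [← (Lp.fourierTransformₗᵢ H ℂ).norm_map, this]
    have h2 : Lp.fourierTransformₗᵢ H ℂ ((𝓕⁻ s).toLp 2 volume) = s.toLp 2 volume := by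
      refine (SchwartzMap.toLp_fourier_eq (𝓕⁻ s)).trans ?_
      rw [FourierTransform.fourier_fourierInv_eq]
    rw [h2]; rfl
  have e2 : eLpNorm (h - 𝓕⁻ φ) 2 volume = ‖hh.toLp - (𝓕⁻ s).toLp 2 volume‖ₑ := by
    rw [Lp.enorm_def]
    apply eLpNorm_congr_ae
    filter_upwards [Lp.coeFn_sub hh.toLp ((𝓕⁻ s).toLp 2 volume), hh.coeFn_toLp,
      (𝓕⁻ s).coeFn_toLp 2 volume] with x h1 h2 h3
    rw [h1, Pi.sub_apply, Pi.sub_apply, h2, h3, ← fourierInv_coe_toSchwartzMap hc hs]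
  have e3 : eLpNorm (⇑(𝓕 hh.toLp : Lp ℂ 2 (volume : Measure H)) - φ) 2 volume
      = ‖(𝓕 hh.toLp : Lp ℂ 2 (volume : Measure H)) - s.toLp 2 volume‖ₑ := by
    rw [Lp.enorm_def]
    apply eLpNorm_congr_ae
    filter_upwards [Lp.coeFn_sub (𝓕 hh.toLp : Lp ℂ 2 (volume : Measure H)) (s.toLp 2 volume),
      s.coeFn_toLp 2 volume] with x h1 h3
    rw [h1, Pi.sub_apply, Pi.sub_apply, h3]; rfl
  rw [e2, ← ofReal_norm, e1, ofReal_norm, ← e3]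
  exact hφ

theorem fourierInv_convolution {φ ψ : H → ℂ} (h1 : Integrable φ) (h2 : Integrable ψ) :
    𝓕⁻ (convolution φ ψ (ContinuousLinearMap.mul ℂ ℂ) volume) = 𝓕⁻ φ * 𝓕⁻ ψ := by
  ext x
  simp only [Pi.mul_apply, Real.fourierInv_eq_fourier_neg]
  exact Real.fourier_mul_convolution_eq h1 h2 _

/-- The Fourier transforms of test functions are dense in `L¹`: a compactly supported function is a
product of two functions in `L²`, each of which is approximated by Fourier transforms of test
functions, and a product of two Fourier transforms is the transform of a convolution. -/
theorem exists_lintegral_sub_fourierInv_le {h : H → ℂ} (hh : Integrable h) {ε : ℝ}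
    (hε : 0 < ε) : ∃ φ : H → ℂ, HasCompactSupport φ ∧ ContDiff ℝ ∞ φ ∧
      ∫⁻ x, ‖h x - 𝓕⁻ φ x‖ₑ ≤ ENNReal.ofReal ε := by
  obtain ⟨h₁, hc, hs, hle⟩ := MemLp.exist_eLpNorm_sub_le (p := 1) (by simp) le_rfl
    (memLp_one_iff_integrable.2 hh) (ε := ε / 3) (by positivity)
  obtain ⟨χ, hχ1, -, hχc, -⟩ := exists_continuous_one_zero_of_isCompact (X := H) hc.isCompact
    isClosed_empty (Set.disjoint_empty _)
  let h₂ : H → ℂ := fun x => (χ x : ℂ)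
  -- the factorization into two functions in `L²`
  have h12 : h₁ = h₁ • h₂ := by
    ext x
    by_cases hx : x ∈ tsupport h₁
    · simp [h₂, hχ1 hx]
    · simp [image_eq_zero_of_notMem_tsupport hx]
  have m1 : MemLp h₁ 2 volume := hs.continuous.memLp_of_hasCompactSupport hc
  have m2 : MemLp h₂ 2 volume := by
    refine Continuous.memLp_of_hasCompactSupport (by fun_prop) ?_
    exact hχc.comp_left Complex.ofReal_zero
  have aux : ∀ A : ENNReal, A ≠ ⊤ →
      ∃ δ : ℝ, 0 < δ ∧ ENNReal.ofReal δ * A ≤ ENNReal.ofReal (ε / 3) := by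
    intro A hA
    refine ⟨ε / 3 / (A.toReal + 1), by positivity, ?_⟩
    nth_rewrite 2 [← ENNReal.ofReal_toReal hA]
    rw [← ENNReal.ofReal_mul (by positivity)]
    apply ENNReal.ofReal_le_ofReal
    rw [div_mul_eq_mul_div, div_le_iff₀ (by positivity)]
    nlinarith [A.toReal_nonneg]
  obtain ⟨δ₁, hδ₁, hd1⟩ := aux _ m2.eLpNorm_ne_top
  obtain ⟨φ₁, c1, s1, n1⟩ := exists_eLpNorm_sub_fourierInv_le m1 hδ₁
  obtain ⟨δ₂, hδ₂, hd2⟩ := aux _ (memLp_fourierInv c1 s1 2).eLpNorm_ne_top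
  obtain ⟨φ₂, c2, s2, n2⟩ := exists_eLpNorm_sub_fourierInv_le m2 hδ₂
  refine ⟨convolution φ₁ φ₂ (ContinuousLinearMap.mul ℂ ℂ) volume, ?_, ?_, ?_⟩
  · exact c1.convolution _ c2
  · exact HasCompactSupport.contDiff_convolution_left (𝕜 := ℝ)
      (L := (ContinuousLinearMap.mul ℝ ℂ)) c1 s1 s2.continuous.locallyIntegrable
  · have i1 := s1.continuous.integrable_of_hasCompactSupport (μ := volume) c1
    have i2 := s2.continuous.integrable_of_hasCompactSupport (μ := volume) c2
    rw [fourierInv_convolution i1 i2]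
    set F₁ := 𝓕⁻ φ₁
    set F₂ := 𝓕⁻ φ₂
    have mF1 : MemLp F₁ 2 volume := memLp_fourierInv c1 s1 2
    have mF2 : MemLp F₂ 2 volume := memLp_fourierInv c2 s2 2
    -- replace `h` by `h₁ = h₁ • h₂`, then one factor after the other by its approximation
    have e : (fun x => h x - (F₁ * F₂) x) = (h - h₁) + ((h₁ - F₁) • h₂ + F₁ • (h₂ - F₂)) := by
      ext x
      have := congrFun h12 x
      simp only [Pi.smul_apply', smul_eq_mul] at this
      simp only [Pi.mul_apply, Pi.add_apply, Pi.sub_apply, smul_eq_mul]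
      linear_combination this
    rw [← eLpNorm_one_eq_lintegral_enorm, e]
    have a1 : AEStronglyMeasurable (h - h₁) volume :=
      hh.aestronglyMeasurable.sub m1.aestronglyMeasurable
    have a2 : AEStronglyMeasurable ((h₁ - F₁) • h₂) volume :=
      (m1.aestronglyMeasurable.sub mF1.aestronglyMeasurable).smul m2.aestronglyMeasurable
    have a3 : AEStronglyMeasurable (F₁ • (h₂ - F₂)) volume :=
      mF1.aestronglyMeasurable.smul (m2.aestronglyMeasurable.sub mF2.aestronglyMeasurable)
    have b2 : eLpNorm ((h₁ - F₁) • h₂) 1 volume ≤ ENNReal.ofReal (ε / 3) := by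
      refine (eLpNorm_smul_le_mul_eLpNorm (p := 2) (q := 2) m2.aestronglyMeasurable
        (m1.aestronglyMeasurable.sub mF1.aestronglyMeasurable)).trans ?_
      exact (mul_le_mul_left n1 _).trans hd1
    have b3 : eLpNorm (F₁ • (h₂ - F₂)) 1 volume ≤ ENNReal.ofReal (ε / 3) := by
      refine (eLpNorm_smul_le_mul_eLpNorm (p := 2) (q := 2)
        (m2.aestronglyMeasurable.sub mF2.aestronglyMeasurable) mF1.aestronglyMeasurable).trans ?_
      rw [mul_comm]
      exact (mul_le_mul_left n2 _).trans hd2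
    calc _ ≤ _ := eLpNorm_add_le a1 (a2.add a3) le_rfl
      _ ≤ ENNReal.ofReal (ε / 3) + (ENNReal.ofReal (ε / 3) + ENNReal.ofReal (ε / 3)) :=
        add_le_add hle ((eLpNorm_add_le a2 a3 le_rfl).trans (add_le_add b2 b3))
      _ = ENNReal.ofReal ε := by
        rw [← ENNReal.ofReal_add (by positivity) (by positivity),
          ← ENNReal.ofReal_add (by positivity) (by positivity)]
        congr 1; ring

theorem lintegral_enorm_sq_eq_ofReal {α : Type*} [MeasurableSpace α] {μ : Measure α} {f : α → ℂ}
    (hf : MemLp f 2 μ) : ∫⁻ x, ‖f x‖ₑ ^ 2 ∂μ = ENNReal.ofReal (∫ x, ‖f x‖ ^ 2 ∂μ) := by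
  rw [ofReal_integral_eq_lintegral_ofReal]
  · refine lintegral_congr fun x => ?_
    rw [ENNReal.ofReal_pow (norm_nonneg _), ofReal_norm]
  · exact (memLp_two_iff_integrable_sq_norm hf.1).1 hf
  · exact Filter.Eventually.of_forall fun x => by positivity

theorem lintegral_enorm_sq_fourierInv {φ : H → ℂ} (hc : HasCompactSupport φ)
    (hs : ContDiff ℝ ∞ φ) : ∫⁻ x, ‖𝓕⁻ φ x‖ₑ ^ 2 = ∫⁻ x, ‖φ x‖ₑ ^ 2 := by
  rw [lintegral_enorm_sq_eq_ofReal (memLp_fourierInv hc hs 2),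
    lintegral_enorm_sq_eq_ofReal (hs.continuous.memLp_of_hasCompactSupport hc)]
  have := SchwartzMap.integral_norm_sq_fourier (𝓕⁻ (hc.toSchwartzMap hs))
  simp only [FourierTransform.fourier_fourierInv_eq] at this
  rw [← fourierInv_coe_toSchwartzMap hc hs, ← this]
  rfl

/-- Plancherel's inequality for continuous functions of compact support, with the explicit bound
that the approximation by test functions gives. -/
theorem lintegral_enorm_sq_fourierInv_le {φ : H → ℂ} (hc : HasCompactSupport φ)
    (hs : Continuous φ) {C : ℝ} (hC : ∀ x, ‖φ x‖ ≤ C) {K : Set H} (hK : MeasurableSet K)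
    (hφK : ∀ x ∉ K, φ x = 0) :
    ∫⁻ x, ‖𝓕⁻ φ x‖ₑ ^ 2 ≤ ENNReal.ofReal (C + 1) ^ 2 * volume K := by
  -- approximate `φ` uniformly by test functions `g n` and pass to the limit with Fatou's lemma
  have happ : ∀ n : ℕ, ∃ g : H → ℂ, ContDiff ℝ ∞ g ∧ (∀ x, dist (g x) (φ x) < 1 / ((n : ℝ) + 1)) ∧
      Function.support g ⊆ Function.support φ := fun n =>
    hs.exists_contDiff_approx ⊤ (by fun_prop) (fun _ => by positivity)
  choose g hg1 hg2 hg3 using happ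
  have hgc : ∀ n, HasCompactSupport (g n) := fun n => hc.mono (hg3 n)
  have hpos : ∀ n : ℕ, 1 / ((n : ℝ) + 1) ≤ 1 := fun n => by
    rw [div_le_one (by positivity)]; linarith [n.cast_nonneg (α := ℝ)]
  have hlim : ∀ x, Filter.Tendsto (fun n => g n x) Filter.atTop (nhds (φ x)) := by
    intro x
    rw [tendsto_iff_dist_tendsto_zero]
    exact squeeze_zero (fun _ => dist_nonneg) (fun n => (hg2 n x).le)
      tendsto_one_div_add_atTop_nhds_zero_nat
  have hb : ∀ n x, ‖g n x‖ ≤ ‖φ x‖ + (tsupport φ).indicator 1 x := by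
    intro n x
    by_cases hx : x ∈ tsupport φ
    · have := hg2 n x
      rw [dist_eq_norm] at this
      have h2 := norm_le_norm_add_norm_sub' (g n x) (φ x)
      simp only [Set.indicator_of_mem hx, Pi.one_apply]
      linarith [hpos n]
    · have : g n x = 0 := by
        by_contra h
        exact hx (subset_tsupport _ (hg3 n h))
      rw [this, norm_zero, Set.indicator_of_notMem hx]
      positivity
  have hlimF : ∀ y, Filter.Tendsto (fun n => ‖𝓕⁻ (g n) y‖ₑ ^ 2) Filter.atTop
      (nhds (‖𝓕⁻ φ y‖ₑ ^ 2)) := by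
    intro y
    refine ((ENNReal.continuous_pow 2).comp continuous_enorm |>.tendsto _).comp ?_
    simp only [Real.fourierInv_eq]
    refine tendsto_integral_of_dominated_convergence
      (fun x => ‖φ x‖ + (tsupport φ).indicator 1 x) ?_ ?_ ?_ ?_
    · intro n
      have := (hg1 n).continuous
      have := Real.continuous_fourierChar
      exact Continuous.aestronglyMeasurable (by fun_prop)
    · refine (hs.integrable_of_hasCompactSupport hc).norm.add ?_
      exact (integrable_indicator_iff (isClosed_tsupport φ).measurableSet).2
        (integrableOn_const (hs := hc.isCompact.measure_lt_top.ne))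
    · intro n
      exact Filter.Eventually.of_forall fun x => by simpa using hb n x
    · exact Filter.Eventually.of_forall fun x => (hlim x).const_smul _
  have hle : ∀ n, ∫⁻ x, ‖𝓕⁻ (g n) x‖ₑ ^ 2 ≤ ENNReal.ofReal (C + 1) ^ 2 * volume K := by
    intro n
    rw [lintegral_enorm_sq_fourierInv (hgc n) (hg1 n), ← setLIntegral_const,
      ← lintegral_indicator hK]
    refine lintegral_mono fun x => ?_
    by_cases hx : x ∈ K
    · rw [Set.indicator_of_mem hx]
      gcongr
      rw [← ofReal_norm]
      apply ENNReal.ofReal_le_ofReal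
      have := hg2 n x
      rw [dist_eq_norm] at this
      linarith [norm_le_norm_add_norm_sub' (g n x) (φ x), hpos n, hC x]
    · have : g n x = 0 := by
        by_contra h
        exact hg3 n h (hφK x hx)
      simp [this]
  calc ∫⁻ x, ‖𝓕⁻ φ x‖ₑ ^ 2 = ∫⁻ x, Filter.liminf (fun n => ‖𝓕⁻ (g n) x‖ₑ ^ 2) Filter.atTop := by
        refine lintegral_congr fun x => ?_
        exact (hlimF x).liminf_eq.symm
    _ ≤ Filter.liminf (fun n => ∫⁻ x, ‖𝓕⁻ (g n) x‖ₑ ^ 2) Filter.atTop := by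
        refine lintegral_liminf_le fun n => ?_
        exact ((fourierInv_coe_toSchwartzMap (hgc n) (hg1 n) ▸
          (SchwartzMap.continuous _)).enorm.measurable.pow_const 2)
    _ ≤ _ := by
        refine Filter.liminf_le_of_frequently_le' (Filter.Frequently.of_forall hle)

end InnerProduct

/-! ### The Fourier transform in linear coordinates -/

theorem continuous_integral_of_forall_notMem_eq_zero {A B : Type*} [TopologicalSpace A]
    [TopologicalSpace B] [MeasurableSpace B] [OpensMeasurableSpace B] {μ : Measure B}
    [IsFiniteMeasureOnCompacts μ] [FirstCountableTopology A]
    [LocallyCompactSpace A] [WeaklyLocallyCompactSpace B]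
    {F : A → B → ℂ} (hF : Continuous F.uncurry) {K : Set B} (hK : IsCompact K)
    (h0 : ∀ a, ∀ b ∉ K, F a b = 0) : Continuous fun a => ∫ b, F a b ∂μ := by
  have := continuous_parametric_integral_of_continuous (μ := μ) hF hK
  convert! this using 2 with a
  exact (setIntegral_eq_integral_of_forall_compl_eq_zero (h0 a)).symm

section Coordinates

variable {E H : Type} [NormedAddCommGroup E] [NormedSpace ℝ E] [MeasureSpace E] [BorelSpace E]
  [NormedAddCommGroup H] [InnerProductSpace ℝ H] [FiniteDimensional ℝ H]
  [MeasurableSpace H] [BorelSpace H]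

/-- The Fourier transform `k ↦ ∫ e(⟨k, w⟩) g(w) dw` on `E`, where the pairing `⟨k, w⟩` is the inner
product of `H`, transported by the linear isomorphism `e`. This is used for products of spaces `ℝᵐ`,
whose norm is not Euclidean. -/
def ft (e : E ≃L[ℝ] H) (g : E → ℂ) (k : E) : ℂ :=
  ∫ w, (Real.fourierChar (inner ℝ (e w) (e k)) : ℂ) * g w

theorem ft_eq {e : E ≃L[ℝ] H} (he : MeasurePreserving e) (g : E → ℂ) (k : E) :
    ft e g k = 𝓕⁻ (g ∘ e.symm) (e k) := by
  rw [Real.fourierInv_eq, ← he.integral_comp e.toHomeomorph.measurableEmbedding]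
  simp [ft, Circle.smul_def]

theorem integral_fourierChar_neg_mul_ft {e : E ≃L[ℝ] H} (he : MeasurePreserving e) {g : E → ℂ}
    (hc : Continuous g) (hi : Integrable g) (hF : Integrable (ft e g)) (w : E) :
    ∫ k, (Real.fourierChar (-inner ℝ (e w) (e k)) : ℂ) * ft e g k = g w := by
  have me := e.toHomeomorph.measurableEmbedding
  have e1 : ft e g = 𝓕⁻ (g ∘ e.symm) ∘ e := funext fun k => ft_eq he g k
  have h1 : Integrable (g ∘ e.symm) := by
    rw [← he.integrable_comp_emb me]
    simpa [Function.comp_def] using hi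
  have h2 : Integrable (𝓕⁻ (g ∘ e.symm)) := by
    rw [← he.integrable_comp_emb me, ← e1]; exact hF
  have h3 := congrFun ((hc.comp e.symm.continuous).fourier_fourierInv_eq h1
    (by rw [Real.fourierInv_eq_fourier_comp_neg] at h2
        have := h2.comp_neg
        convert! this using 2 with x
        rw [← Real.fourierInv_eq_fourier_comp_neg, Real.fourierInv_eq_fourier_neg]
        simp)) (e w)
  rw [Function.comp_apply, e.symm_apply_apply, Real.fourier_eq,
    ← he.integral_comp me] at h3
  rw [← h3]
  refine integral_congr_ae (Filter.Eventually.of_forall fun k => ?_)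
  simp only [e1, Function.comp_apply, Circle.smul_def, smul_eq_mul, real_inner_comm]

theorem integrable_ft {e : E ≃L[ℝ] H} (he : MeasurePreserving e) {g : E → ℂ}
    (hs : ContDiff ℝ ∞ g) (hc : HasCompactSupport g) : Integrable (ft e g) := by
  have me := e.toHomeomorph.measurableEmbedding
  have e1 : ft e g = 𝓕⁻ (g ∘ e.symm) ∘ e := funext fun k => ft_eq he g k
  rw [e1, he.integrable_comp_emb me, ← memLp_one_iff_integrable]
  exact memLp_fourierInv (hc.comp_homeomorph e.symm.toHomeomorph)
    (hs.comp e.symm.contDiff) 1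

theorem lintegral_enorm_sq_ft_le {e : E ≃L[ℝ] H} (he : MeasurePreserving e) {g : E → ℂ}
    (hs : Continuous g) (hc : HasCompactSupport g) {C : ℝ} (hC : ∀ x, ‖g x‖ ≤ C) {K : Set E}
    (hK : MeasurableSet K) (hgK : ∀ x ∉ K, g x = 0) :
    ∫⁻ x, ‖ft e g x‖ₑ ^ 2 ≤ ENNReal.ofReal (C + 1) ^ 2 * volume K := by
  have me := e.toHomeomorph.measurableEmbedding
  have hK' : MeasurableSet (e.symm ⁻¹' K) := e.symm.continuous.measurable hK
  have := lintegral_enorm_sq_fourierInv_le (hc.comp_homeomorph e.symm.toHomeomorph)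
    (hs.comp e.symm.continuous) (C := C) (fun x => hC _) hK' (fun x hx => hgK _ hx)
  rw [← he.lintegral_comp_emb me, ← he.measure_preimage hK'.nullMeasurableSet,
    ← Set.preimage_comp] at this
  simpa [ft_eq he, Function.comp_def] using! this

theorem exists_lintegral_sub_ft_le {e : E ≃L[ℝ] H} (he : MeasurePreserving e) {h : E → ℂ}
    (hh : Integrable h) {ε : ℝ} (hε : 0 < ε) :
    ∃ φ : E → ℂ, HasCompactSupport φ ∧ ContDiff ℝ ∞ φ ∧
      ∫⁻ x, ‖h x - ft e φ x‖ₑ ≤ ENNReal.ofReal ε := by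
  have me := e.toHomeomorph.measurableEmbedding
  obtain ⟨φ, hc, hs, hφ⟩ := exists_lintegral_sub_fourierInv_le (h := h ∘ e.symm) (by
    rw [← he.integrable_comp_emb me]
    simpa [Function.comp_def] using hh) hε
  refine ⟨φ ∘ e, hc.comp_homeomorph e.toHomeomorph, hs.comp e.contDiff, ?_⟩
  rw [← he.lintegral_comp_emb me] at hφ
  simpa [ft_eq he, Function.comp_def] using! hφ

end Coordinates

section Product

variable {E₁ H₁ E₂ H₂ : Type}
  [NormedAddCommGroup E₁] [NormedSpace ℝ E₁] [NormedAddCommGroup H₁] [InnerProductSpace ℝ H₁]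
  [NormedAddCommGroup E₂] [NormedSpace ℝ E₂] [NormedAddCommGroup H₂] [InnerProductSpace ℝ H₂]

/-- The coordinates on a product, in the Euclidean product `H₁ × H₂`. -/
def prodCoord (e₁ : E₁ ≃L[ℝ] H₁) (e₂ : E₂ ≃L[ℝ] H₂) : (E₁ × E₂) ≃L[ℝ] WithLp 2 (H₁ × H₂) :=
  (e₁.prodCongr e₂).trans (WithLp.prodContinuousLinearEquiv 2 ℝ H₁ H₂).symm

theorem inner_prodCoord (e₁ : E₁ ≃L[ℝ] H₁) (e₂ : E₂ ≃L[ℝ] H₂) (w k : E₁ × E₂) :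
    inner ℝ (prodCoord e₁ e₂ w) (prodCoord e₁ e₂ k) =
      inner ℝ (e₁ w.1) (e₁ k.1) + inner ℝ (e₂ w.2) (e₂ k.2) := by
  simp [prodCoord, WithLp.prod_inner_apply]

variable [MeasureSpace E₁] [MeasureSpace E₂] [FiniteDimensional ℝ H₁] [MeasurableSpace H₁]
  [BorelSpace H₁] [FiniteDimensional ℝ H₂]
  [SFinite (volume : Measure E₁)] [SFinite (volume : Measure E₂)]

theorem measurePreserving_prodCoord [MeasurableSpace H₂] [BorelSpace H₂]
    {e₁ : E₁ ≃L[ℝ] H₁} {e₂ : E₂ ≃L[ℝ] H₂} (h₁ : MeasurePreserving e₁) (h₂ : MeasurePreserving e₂) :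
    MeasurePreserving (prodCoord e₁ e₂) :=
  (WithLp.volume_preserving_toLp H₁ H₂).comp (h₁.prod h₂)

variable [BorelSpace E₁] [BorelSpace E₂] [IsFiniteMeasureOnCompacts (volume : Measure E₁)]
  [IsFiniteMeasureOnCompacts (volume : Measure E₂)]

/-- Fourier inversion in the first of two groups of variables, under the assumption that the full
Fourier transform is integrable. The exceptional null set of frequencies does not depend on the
point `w₁`. -/
theorem ae_partial_fourier_inversion {e₁ : E₁ ≃L[ℝ] H₁} {e₂ : E₂ ≃L[ℝ] H₂}
    (h₁ : MeasurePreserving e₁) {g : E₁ × E₂ → ℂ}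
    (hg : Continuous g) (hc : HasCompactSupport g)
    (hF : Integrable (ft (prodCoord e₁ e₂) g)) :
    ∀ᵐ k₂ : E₂, Integrable (fun k₁ => ft (prodCoord e₁ e₂) g (k₁, k₂)) ∧
      ∀ w₁ : E₁, ft e₂ (fun w₂ => g (w₁, w₂)) k₂ =
        ∫ k₁, (Real.fourierChar (-inner ℝ (e₁ w₁) (e₁ k₁)) : ℂ) *
          ft (prodCoord e₁ e₂) g (k₁, k₂) := by
  have : FiniteDimensional ℝ E₁ := e₁.symm.toLinearEquiv.finiteDimensional
  have : FiniteDimensional ℝ E₂ := e₂.symm.toLinearEquiv.finiteDimensional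
  have : ProperSpace E₁ := FiniteDimensional.proper ℝ E₁
  have : ProperSpace E₂ := FiniteDimensional.proper ℝ E₂
  have hF' : Integrable (ft (prodCoord e₁ e₂) g)
    ((volume : Measure E₁).prod (volume : Measure E₂)) := hF
  have hK₁ : IsCompact (Prod.fst '' tsupport g) := hc.isCompact.image continuous_fst
  have hK₂ : IsCompact (Prod.snd '' tsupport g) := hc.isCompact.image continuous_snd
  have z₁ : ∀ w₁ ∉ Prod.fst '' tsupport g, ∀ w₂, g (w₁, w₂) = 0 := fun w₁ h w₂ =>
    image_eq_zero_of_notMem_tsupport fun hw => h ⟨_, hw, rfl⟩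
  have z₂ : ∀ w₁, ∀ w₂ ∉ Prod.snd '' tsupport g, g (w₁, w₂) = 0 := fun w₁ w₂ h =>
    image_eq_zero_of_notMem_tsupport fun hw => h ⟨_, hw, rfl⟩
  -- for almost every `k₂`, inversion applies to the transform of `g` in the second variable at `k₂`
  filter_upwards [hF'.prod_left_ae] with k₂ hk₂
  refine ⟨hk₂, ?_⟩
  have c1 := Real.continuous_fourierChar
  have hcont : Continuous fun w₁ : E₁ => ft e₂ (fun w₂ => g (w₁, w₂)) k₂ := by
    unfold ft
    refine continuous_integral_of_forall_notMem_eq_zero ?_ hK₂ fun w₁ w₂ h =>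
      mul_eq_zero_of_right _ (z₂ w₁ w₂ h)
    simp only [Function.uncurry_def]
    fun_prop
  have hsupp : HasCompactSupport fun w₁ : E₁ => ft e₂ (fun w₂ => g (w₁, w₂)) k₂ := by
    refine HasCompactSupport.intro hK₁ fun w₁ h => ?_
    simp [ft, z₁ w₁ h]
  have hft : ft e₁ (fun w₁ => ft e₂ (fun w₂ => g (w₁, w₂)) k₂) =
      fun k₁ => ft (prodCoord e₁ e₂) g (k₁, k₂) := by
    funext k₁
    have hcg : Continuous fun w : E₁ × E₂ =>
        (Real.fourierChar (inner ℝ (prodCoord e₁ e₂ w) (prodCoord e₁ e₂ (k₁, k₂))) : ℂ) * g w := by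
      fun_prop
    have hint := hcg.integrable_of_hasCompactSupport
      (μ := (volume : Measure E₁).prod (volume : Measure E₂)) hc.mul_left
    simp only [ft]
    rw [Measure.volume_eq_prod, integral_prod _ hint]
    refine integral_congr_ae (Filter.Eventually.of_forall fun w₁ => ?_)
    simp only [inner_prodCoord]
    rw [← integral_const_mul]
    refine integral_congr_ae (Filter.Eventually.of_forall fun w₂ => ?_)
    simp only [AddChar.map_add_eq_mul, Circle.coe_mul, mul_assoc]
  intro w₁
  have := integral_fourierChar_neg_mul_ft h₁ hcont
    (hcont.integrable_of_hasCompactSupport hsupp) (by rw [hft]; exact hk₂) w₁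
  rw [hft] at this
  exact this.symm

end Product

/-- The Euclidean coordinates on `ℝⁿ`. -/
def coordV (n : ℕ) : V n ≃L[ℝ] EuclideanSpace ℝ (Fin n) := (EuclideanSpace.equiv (Fin n) ℝ).symm

theorem measurePreserving_coordV (n : ℕ) : MeasurePreserving (coordV n) :=
  PiLp.volume_preserving_toLp (Fin n)

theorem inner_coordV {n : ℕ} (w k : V n) : inner ℝ (coordV n w) (coordV n k) = k ⬝ᵥ w := by
  simp [coordV, EuclideanSpace.inner_eq_star_dotProduct]

/-- The Euclidean coordinates on `ℝⁿ × ℝⁿ`. -/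
def coordW (n : ℕ) :
    (V n × V n) ≃L[ℝ] WithLp 2 (EuclideanSpace ℝ (Fin n) × EuclideanSpace ℝ (Fin n)) :=
  prodCoord (coordV n) (coordV n)

theorem measurePreserving_coordW (n : ℕ) : MeasurePreserving (coordW n) :=
  measurePreserving_prodCoord (measurePreserving_coordV n) (measurePreserving_coordV n)

theorem fourierChar_coordW {n : ℕ} (w k : V n × V n) :
    Real.fourierChar (inner ℝ (coordW n w) (coordW n k)) = pairing k w := by
  rw [coordW, inner_prodCoord, inner_coordV, inner_coordV, pairing]

theorem ft_coordW {n : ℕ} (g : V n × V n → ℂ) (k : V n × V n) :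
    ft (coordW n) g k = ∫ w, (pairing k w : ℂ) * g w := by
  simp only [ft, fourierChar_coordW]

theorem pairing_comm {n : ℕ} (k w : V n × V n) : pairing k w = pairing w k := by
  simp [pairing, dotProduct_comm]

theorem pft_eq_ft {n : ℕ} (φ : X n → ℂ) (w : V n × V n) (r : ℝ) :
    pft φ w r = ft (coordW n) (fun k => φ (k.1, k.2, r)) w := by
  rw [ft_coordW]
  unfold pft
  refine integral_congr_ae (Filter.Eventually.of_forall fun k => ?_)
  simp only [pairing_comm w k, mul_comm]

/-! ### Twisted convolution operators -/

/-- The translate `(x - x̃, y - ỹ, r)` of `u = (x, y, r)` by `w = (x̃, ỹ)`. -/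
def tr {n : ℕ} (u : X n) (w : V n × V n) : X n := (u.1 - w.1, u.2.1 - w.2, u.2.2)

/-- The integrand of the twisted convolution of `ζ` with the symbol `f(x, y; r)`. For `f = φ^∨` it is
`regIntegrand J φ ζ`. -/
def twInt {n : ℕ} (J : Matrix (Fin n) (Fin n) ℝ) (f : V n × V n → ℝ → ℂ) (ζ : X n → ℂ) (u : X n)
    (w : V n × V n) : ℂ :=
  f w u.2.2 * sigma J u.2.2 w (u.1 - w.1, u.2.1 - w.2) * ζ (tr u w)

/-- `T` is the operator of twisted convolution with the symbol `f`. -/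
def IsTw {n : ℕ} (J : Matrix (Fin n) (Fin n) ℝ) (f : V n × V n → ℝ → ℂ)
    (T : L2 (X n) →L[ℂ] L2 (X n)) : Prop :=
  ∀ ζ : L2 (X n), ∀ᵐ u : X n, Integrable (twInt J f ζ u) ∧ T ζ u = ∫ w, twInt J f ζ u w

theorem isReg_iff_isTw {n : ℕ} {J : Matrix (Fin n) (Fin n) ℝ} {φ : X n → ℂ}
    {T : L2 (X n) →L[ℂ] L2 (X n)} : IsReg J φ T ↔ IsTw J (pft φ) T := Iff.rfl

variable {n : ℕ}

theorem continuous_tr : Continuous fun p : X n × (V n × V n) => tr p.1 p.2 := by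
  unfold tr; fun_prop

theorem measurePreserving_tr (w : V n × V n) : MeasurePreserving fun u : X n => tr u w := by
  convert! measurePreserving_add_right (volume : Measure (X n)) ((-w.1, -w.2, 0) : X n) using 2 with u
  simp [tr, sub_eq_add_neg, Prod.ext_iff]

theorem ae_ae_tr {p : X n → Prop} (h : ∀ᵐ v, p v) : ∀ᵐ u : X n, ∀ᵐ w : V n × V n, p (tr u w) := by
  have h1 : MeasurePreserving (fun q : (V n × V n) × X n => (q.1, tr q.2 q.1)) :=
    (MeasurePreserving.id (volume : Measure (V n × V n))).skew_product
      (g := fun w u => tr u w) (μc := (volume : Measure (X n))) (μd := (volume : Measure (X n)))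
      (continuous_tr.comp continuous_swap).measurable
      (Filter.Eventually.of_forall fun w => (measurePreserving_tr w).map_eq)
  have h2 := (Measure.quasiMeasurePreserving_snd.comp h1.quasiMeasurePreserving).comp
    (Measure.measurePreserving_swap (μ := (volume : Measure (X n)))
      (ν := (volume : Measure (V n × V n)))).quasiMeasurePreserving
  exact Measure.ae_ae_of_ae_prod (h2.ae h)

/-- Translation invariance, fibre by fibre in `r`. -/
theorem lintegral_lintegral_tr {F : V n × V n → ℝ → ENNReal} {G : X n → ENNReal}
    (hF : Measurable fun p : (V n × V n) × ℝ => F p.1 p.2) (hG : Measurable G) :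
    ∫⁻ u : X n, ∫⁻ w, F w u.2.2 * G (tr u w) = ∫⁻ u : X n, (∫⁻ w, F w u.2.2) * G u := by
  have m1 : Measurable fun p : X n × (V n × V n) => F p.2 p.1.2.2 :=
    hF.comp (f := fun p : X n × (V n × V n) => (p.2, p.1.2.2)) (by fun_prop)
  rw [lintegral_lintegral_swap
    (m1.mul (hG.comp continuous_tr.measurable)).aemeasurable]
  have : ∀ w, ∫⁻ u : X n, F w u.2.2 * G (tr u w) = ∫⁻ u : X n, F w u.2.2 * G u := by
    intro w
    have mw : Measurable fun u : X n => F w u.2.2 * G u :=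
      (m1.comp (f := fun u : X n => (u, w)) (by fun_prop)).mul hG
    exact (measurePreserving_tr w).lintegral_comp mw
  simp_rw [this]
  rw [← lintegral_lintegral_swap (f := fun (u : X n) (w : V n × V n) => F w u.2.2 * G u)
    (m1.mul (hG.comp measurable_fst)).aemeasurable]
  refine lintegral_congr fun u => ?_
  exact lintegral_mul_const _ (m1.comp (f := fun w => (u, w)) (by fun_prop))

theorem eLpNorm_two_sq {α : Type*} [MeasurableSpace α] {μ : Measure α} (f : α → ℂ) :
    eLpNorm f 2 μ ^ 2 = ∫⁻ x, ‖f x‖ₑ ^ 2 ∂μ := by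
  have := eLpNorm_nnreal_pow_eq_lintegral (f := f) (μ := μ) (p := 2) (by norm_num)
  simpa using this

/-- The Cauchy–Schwarz inequality for the measure with density `a`. -/
theorem lintegral_mul_sq_le {α : Type*} [MeasurableSpace α] {μ : Measure α} {a b : α → ENNReal}
    (ha : AEMeasurable a μ) (hb : AEMeasurable b μ) :
    (∫⁻ x, a x * b x ∂μ) ^ 2 ≤ (∫⁻ x, a x ∂μ) * ∫⁻ x, a x * b x ^ 2 ∂μ := by
  have h := ENNReal.lintegral_mul_le_Lp_mul_Lq μ (p := 2) (q := 2) (by constructor <;> norm_num)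
    (ha.pow_const (1 / 2 : ℝ)) ((ha.pow_const (1 / 2 : ℝ)).mul hb)
  have hsq : ∀ t : ENNReal, t ^ (1 / 2 : ℝ) * t ^ (1 / 2 : ℝ) = t := fun t => by
    rw [← ENNReal.rpow_add_of_nonneg _ _ (by norm_num) (by norm_num)]; norm_num
  have hsq' : ∀ t : ENNReal, (t ^ (1 / 2 : ℝ)) ^ 2 = t := fun t => by rw [sq, hsq]
  have e1 : (∫⁻ x, a x * b x ∂μ) = ∫⁻ x, ((fun x => a x ^ (1 / 2 : ℝ)) *
      ((fun x => a x ^ (1 / 2 : ℝ)) * b)) x ∂μ := by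
    refine lintegral_congr fun x => ?_
    simp only [Pi.mul_apply, ← mul_assoc, hsq]
  rw [e1]
  refine (pow_le_pow_left' h 2).trans (le_of_eq ?_)
  rw [mul_pow, hsq', hsq']
  congr 1
  · refine lintegral_congr fun x => ?_
    simp only [ENNReal.rpow_two, hsq']
  · refine lintegral_congr fun x => ?_
    simp only [ENNReal.rpow_two, Pi.mul_apply, mul_pow, hsq']

theorem continuous_sigma (J : Matrix (Fin n) (Fin n) ℝ) :
    Continuous fun p : ℝ × (V n × V n) × (V n × V n) => (sigma J p.1 p.2.1 p.2.2 : ℂ) := by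
  unfold sigma
  have := Real.continuous_fourierChar
  fun_prop

theorem measurable_twInt (J : Matrix (Fin n) (Fin n) ℝ) {f : V n × V n → ℝ → ℂ}
    (hf : Measurable fun p : (V n × V n) × ℝ => f p.1 p.2) {ζ : X n → ℂ} (hζ : Measurable ζ) :
    Measurable fun p : X n × (V n × V n) => twInt J f ζ p.1 p.2 := by
  have m1 : Measurable fun p : X n × (V n × V n) => f p.2 p.1.2.2 :=
    hf.comp (f := fun p : X n × (V n × V n) => (p.2, p.1.2.2)) (by fun_prop)
  have m2 : Measurable fun p : X n × (V n × V n) =>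
      (sigma J p.1.2.2 p.2 (p.1.1 - p.2.1, p.1.2.1 - p.2.2) : ℂ) :=
    ((continuous_sigma J).comp (f := fun p : X n × (V n × V n) =>
      (p.1.2.2, p.2, (p.1.1 - p.2.1, p.1.2.1 - p.2.2))) (by fun_prop)).measurable
  exact (m1.mul m2).mul (hζ.comp continuous_tr.measurable)

theorem enorm_circle (c : Circle) : ‖(c : ℂ)‖ₑ = 1 := by
  rw [← ofReal_norm, Circle.norm_coe, ENNReal.ofReal_one]

theorem enorm_twInt (J : Matrix (Fin n) (Fin n) ℝ) (f : V n × V n → ℝ → ℂ) (ζ : X n → ℂ) (u : X n)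
    (w : V n × V n) : ‖twInt J f ζ u w‖ₑ = ‖f w u.2.2‖ₑ * ‖ζ (tr u w)‖ₑ := by
  rw [twInt, enorm_mul, enorm_mul, enorm_circle, mul_one]

/-- The Schur test for twisted convolution: the norm is at most the largest of the `L¹` norms of the
symbol over the fibres `r = const`. -/
theorem lintegral_lintegral_enorm_twInt_sq_le (J : Matrix (Fin n) (Fin n) ℝ)
    {f : V n × V n → ℝ → ℂ} (hf : Measurable fun p : (V n × V n) × ℝ => f p.1 p.2) {C : ℝ≥0}
    (hC : ∀ r, ∫⁻ w, ‖f w r‖ₑ ≤ C) {ζ : X n → ℂ} (hζ : Measurable ζ) :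
    ∫⁻ u, (∫⁻ w, ‖twInt J f ζ u w‖ₑ) ^ 2 ≤ (C * eLpNorm ζ 2 volume) ^ 2 := by
  simp only [enorm_twInt]
  have m1 : ∀ r, Measurable fun w => f w r := fun r =>
    hf.comp (f := fun w : V n × V n => (w, r)) (by fun_prop)
  have m2 : ∀ u : X n, Measurable fun w => ζ (tr u w) := fun u =>
    hζ.comp (continuous_tr.comp (f := fun w : V n × V n => (u, w)) (by fun_prop)).measurable
  calc ∫⁻ u : X n, (∫⁻ w, ‖f w u.2.2‖ₑ * ‖ζ (tr u w)‖ₑ) ^ 2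
      ≤ ∫⁻ u : X n, C * ∫⁻ w, ‖f w u.2.2‖ₑ * ‖ζ (tr u w)‖ₑ ^ 2 := by
        refine lintegral_mono fun u => ?_
        refine (lintegral_mul_sq_le (m1 _).enorm.aemeasurable (m2 u).enorm.aemeasurable).trans ?_
        gcongr
        exact hC _
    _ = C * ∫⁻ u : X n, (∫⁻ w, ‖f w u.2.2‖ₑ) * ‖ζ u‖ₑ ^ 2 := by
        rw [lintegral_const_mul' _ _ ENNReal.coe_ne_top]
        congr 1
        exact lintegral_lintegral_tr (F := fun w r => ‖f w r‖ₑ) hf.enorm (hζ.enorm.pow_const 2)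
    _ ≤ C * ∫⁻ u : X n, C * ‖ζ u‖ₑ ^ 2 := by
        gcongr with u
        exact hC _
    _ = _ := by
        rw [lintegral_const_mul' _ _ ENNReal.coe_ne_top, mul_pow, eLpNorm_two_sq, sq, mul_assoc]

theorem twInt_congr_ae {J : Matrix (Fin n) (Fin n) ℝ} {f : V n × V n → ℝ → ℂ} {ζ ζ' : X n → ℂ}
    (h : ζ =ᵐ[volume] ζ') : ∀ᵐ u, twInt J f ζ u =ᵐ[volume] twInt J f ζ' u := by
  filter_upwards [ae_ae_tr h] with u hu
  filter_upwards [hu] with w hw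
  rw [twInt, twInt, hw]

theorem ae_integrable_twInt (J : Matrix (Fin n) (Fin n) ℝ)
    {f : V n × V n → ℝ → ℂ} (hf : Measurable fun p : (V n × V n) × ℝ => f p.1 p.2) {C : ℝ≥0}
    (hC : ∀ r, ∫⁻ w, ‖f w r‖ₑ ≤ C) (ζ : L2 (X n)) :
    ∀ᵐ u, Integrable (twInt J f ζ u) := by
  have hζ : Measurable ζ := (Lp.stronglyMeasurable ζ).measurable
  have h := lintegral_lintegral_enorm_twInt_sq_le J hf hC hζ
  have hlt : ∫⁻ u, (∫⁻ w, ‖twInt J f ζ u w‖ₑ) ^ 2 < ⊤ := h.trans_lt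
    (ENNReal.pow_lt_top (ENNReal.mul_lt_top ENNReal.coe_lt_top (Lp.memLp ζ).2))
  have hm := measurable_twInt J hf hζ
  filter_upwards [ae_lt_top (hm.enorm.lintegral_prod_right'.pow_const 2) hlt.ne] with u hu
  exact ⟨(hm.comp measurable_prodMk_left).aestronglyMeasurable,
    (ENNReal.pow_lt_top_iff.1 hu).resolve_right (by norm_num)⟩

theorem eLpNorm_integral_twInt_le (J : Matrix (Fin n) (Fin n) ℝ)
    {f : V n × V n → ℝ → ℂ} (hf : Measurable fun p : (V n × V n) × ℝ => f p.1 p.2) {C : ℝ≥0}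
    (hC : ∀ r, ∫⁻ w, ‖f w r‖ₑ ≤ C) (ζ : L2 (X n)) :
    eLpNorm (fun u => ∫ w, twInt J f ζ u w) 2 volume ≤ C * eLpNorm ζ 2 volume := by
  have hζ : Measurable ζ := (Lp.stronglyMeasurable ζ).measurable
  rw [← ENNReal.pow_le_pow_left_iff two_ne_zero, eLpNorm_two_sq]
  refine le_trans (lintegral_mono fun u => ?_) (lintegral_lintegral_enorm_twInt_sq_le J hf hC hζ)
  gcongr
  exact enorm_integral_le_lintegral_enorm _

theorem memLp_integral_twInt (J : Matrix (Fin n) (Fin n) ℝ)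
    {f : V n × V n → ℝ → ℂ} (hf : Measurable fun p : (V n × V n) × ℝ => f p.1 p.2) {C : ℝ≥0}
    (hC : ∀ r, ∫⁻ w, ‖f w r‖ₑ ≤ C) (ζ : L2 (X n)) :
    MemLp (fun u => ∫ w, twInt J f ζ u w) 2 volume := by
  have hζ : Measurable ζ := (Lp.stronglyMeasurable ζ).measurable
  exact ⟨(measurable_twInt J hf hζ).stronglyMeasurable.integral_prod_right'.aestronglyMeasurable,
    (eLpNorm_integral_twInt_le J hf hC ζ).trans_lt
      (ENNReal.mul_lt_top ENNReal.coe_lt_top (Lp.memLp ζ).2)⟩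

/-- A symbol whose `L¹` norms over the fibres `r = const` are bounded by `C` gives a twisted convolution
operator of norm at most `C`. -/
theorem exists_isTw (J : Matrix (Fin n) (Fin n) ℝ)
    {f : V n × V n → ℝ → ℂ} (hf : Measurable fun p : (V n × V n) × ℝ => f p.1 p.2) {C : ℝ≥0}
    (hC : ∀ r, ∫⁻ w, ‖f w r‖ₑ ≤ C) : ∃ T, IsTw J f T ∧ ‖T‖ ≤ C := by
  have hint := ae_integrable_twInt J hf hC
  have hmem := memLp_integral_twInt J hf hC
  let T₀ : L2 (X n) →ₗ[ℂ] L2 (X n) :=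
    { toFun := fun ζ => (hmem ζ).toLp
      map_add' := fun ζ ζ' => by
        rw [← MemLp.toLp_add]
        apply MemLp.toLp_congr
        filter_upwards [hint ζ, hint ζ', twInt_congr_ae (J := J) (f := f) (Lp.coeFn_add ζ ζ')]
          with u h1 h2 h3
        rw [Pi.add_apply, ← integral_add h1 h2, integral_congr_ae h3]
        refine integral_congr_ae (Filter.Eventually.of_forall fun w => ?_)
        simp only [twInt, Pi.add_apply]
        ring
      map_smul' := fun c ζ => by
        rw [RingHom.id_apply, ← MemLp.toLp_const_smul]
        apply MemLp.toLp_congr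
        filter_upwards [twInt_congr_ae (J := J) (f := f) (Lp.coeFn_smul c ζ)] with u h3
        rw [Pi.smul_apply, ← integral_smul, integral_congr_ae h3]
        refine integral_congr_ae (Filter.Eventually.of_forall fun w => ?_)
        simp only [twInt, Pi.smul_apply, smul_eq_mul]
        ring }
  have hb : ∀ ζ, ‖T₀ ζ‖ ≤ C * ‖ζ‖ := by
    intro ζ
    have h := eLpNorm_integral_twInt_le J hf hC ζ
    change ‖(hmem ζ).toLp‖ ≤ _
    rw [Lp.norm_toLp, Lp.norm_def]
    refine (ENNReal.toReal_mono (ENNReal.mul_ne_top ENNReal.coe_ne_top (Lp.memLp ζ).2.ne) h).trans ?_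
    simp
  refine ⟨T₀.mkContinuous C hb, fun ζ => ?_, LinearMap.mkContinuous_norm_le _ C.2 _⟩
  filter_upwards [hint ζ, (hmem ζ).coeFn_toLp] with u h1 h2
  exact ⟨h1, h2⟩

theorem IsTw.unique {J : Matrix (Fin n) (Fin n) ℝ} {f : V n × V n → ℝ → ℂ}
    {T T' : L2 (X n) →L[ℂ] L2 (X n)} (h : IsTw J f T) (h' : IsTw J f T') : T = T' := by
  ext1 ζ
  apply Lp.ext
  filter_upwards [h ζ, h' ζ] with u h1 h2
  rw [h1.2, h2.2]

theorem IsTw.add {J : Matrix (Fin n) (Fin n) ℝ} {f f' : V n × V n → ℝ → ℂ}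
    {T T' : L2 (X n) →L[ℂ] L2 (X n)} (h : IsTw J f T) (h' : IsTw J f' T') :
    IsTw J (f + f') (T + T') := by
  intro ζ
  filter_upwards [h ζ, h' ζ, Lp.coeFn_add (T ζ) (T' ζ)] with u h1 h2 h3
  have e : twInt J (f + f') ζ u = fun w => twInt J f ζ u w + twInt J f' ζ u w := by
    funext w
    simp only [twInt, Pi.add_apply]
    ring
  rw [e]
  refine ⟨h1.1.add h2.1, ?_⟩
  rw [add_apply, h3, Pi.add_apply, h1.2, h2.2, integral_add h1.1 h2.1]

theorem IsTw.smul {J : Matrix (Fin n) (Fin n) ℝ} {f : V n × V n → ℝ → ℂ}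
    {T : L2 (X n) →L[ℂ] L2 (X n)} (c : ℂ) (h : IsTw J f T) : IsTw J (c • f) (c • T) := by
  intro ζ
  filter_upwards [h ζ, Lp.coeFn_smul c (T ζ)] with u h1 h3
  have e : twInt J (c • f) ζ u = fun w => c * twInt J f ζ u w := by
    funext w
    simp only [twInt, Pi.smul_apply, smul_eq_mul]
    ring
  rw [e]
  refine ⟨h1.1.const_mul c, ?_⟩
  rw [smul_apply, h3, Pi.smul_apply, h1.2, integral_const_mul, smul_eq_mul]

theorem IsTw.norm_sub_le {J : Matrix (Fin n) (Fin n) ℝ} {f f' : V n × V n → ℝ → ℂ}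
    {T T' : L2 (X n) →L[ℂ] L2 (X n)} (h : IsTw J f T) (h' : IsTw J f' T')
    (hf : Measurable fun p : (V n × V n) × ℝ => f p.1 p.2)
    (hf' : Measurable fun p : (V n × V n) × ℝ => f' p.1 p.2) {C : ℝ≥0}
    (hC : ∀ r, ∫⁻ w, ‖f w r - f' w r‖ₑ ≤ C) : ‖T - T'‖ ≤ C := by
  have e : f + (-1 : ℂ) • f' = fun w r => f w r - f' w r := by
    funext w r; simp [sub_eq_add_neg]
  obtain ⟨S, hS, hSC⟩ := exists_isTw J (f := fun w r => f w r - f' w r) (hf.sub hf') hC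
  have h2 := h.add (h'.smul (-1))
  rw [e] at h2
  rw [show T - T' = T + (-1 : ℂ) • T' by simp [sub_eq_add_neg], h2.unique hS]
  exact hSC

/-! ### The multiplicative unitary as a weighted composition operator -/

theorem coeFn_compU_inv {β : Type} [MeasureSpace β] (m : β ≃ᵐ β) (hm : MeasurePreserving m)
    (f : L2 β) : (compU m hm)⁻¹ f =ᵐ[volume] fun z => f (m.symm z) := by
  have h := coeFn_compU m hm ((compU m hm)⁻¹ f)
  have e : compU m hm ((compU m hm)⁻¹ f) = f := (compU m hm).apply_symm_apply f
  rw [e] at h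
  filter_upwards [(hm.symm m).quasiMeasurePreserving.ae h] with z hz
  rw [hz, m.apply_symm_apply]

/-- The map of points underlying `Z₁₂`. -/
def mapZ₁₂ (J : Matrix (Fin n) (Fin n) ℝ) : X n × X n ≃ᵐ X n × X n :=
  (shearL (fun v : V n × ℝ => v.2 • J.mulVec v.1) (by fun_prop)).prodCongr
    (MeasurableEquiv.refl (X n))

/-- The map of points underlying `X₂₄`. -/
def mapX₂₄ (n : ℕ) : X n × X n ≃ᵐ X n × X n :=
  shearL (fun u' : X n => ((0, 0, u'.2.2) : X n)) (by fun_prop)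

/-- The map of points underlying `Y₁₃`. -/
def mapY₁₃ (n : ℕ) : X n × X n ≃ᵐ X n × X n :=
  shearR (fun u : X n => ((-u.1, -u.2.1, 0) : X n)) (by fun_prop)

theorem measurePreserving_mapZ₁₂ (J : Matrix (Fin n) (Fin n) ℝ) :
    MeasurePreserving (mapZ₁₂ J) := (shearL_mp _ _).prod (MeasurePreserving.id _)

theorem measurePreserving_mapX₂₄ (n : ℕ) : MeasurePreserving (mapX₂₄ n) := shearL_mp _ _

theorem measurePreserving_mapY₁₃ (n : ℕ) : MeasurePreserving (mapY₁₃ n) := shearR_mp _ _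

/-- The map of points underlying `V = (Z₁₂ X₂₄ Z₁₂*) Y₁₃`. -/
def mapV (J : Matrix (Fin n) (Fin n) ℝ) : X n × X n ≃ᵐ X n × X n :=
  (((mapZ₁₂ J).trans (mapX₂₄ n)).trans (mapZ₁₂ J).symm).trans (mapY₁₃ n)

theorem measurePreserving_mapV (J : Matrix (Fin n) (Fin n) ℝ) : MeasurePreserving (mapV J) :=
  (((measurePreserving_mapY₁₃ n).comp ((measurePreserving_mapZ₁₂ J).symm _)).comp
    (measurePreserving_mapX₂₄ n)).comp (measurePreserving_mapZ₁₂ J)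

theorem mapV_apply (J : Matrix (Fin n) (Fin n) ℝ) (z : X n × X n) :
    mapV J z = ((z.1.1 - z.2.2.2 • J.mulVec z.1.2.1, z.1.2.1, z.1.2.2 + z.2.2.2),
      (z.2.1 - z.1.1 + z.2.2.2 • J.mulVec z.1.2.1, z.2.2.1 - z.1.2.1, z.2.2.2)) := by
  simp only [mapV, mapZ₁₂, mapX₂₄, mapY₁₃, shearL, shearR, MeasurableEquiv.trans_apply]
  ext <;> simp [MeasurableEquiv.prodCongr, MeasurableEquiv.refl] <;> ring

theorem mapV_symm_apply (J : Matrix (Fin n) (Fin n) ℝ) (z : X n × X n) :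
    (mapV J).symm z = ((z.1.1 + z.2.2.2 • J.mulVec z.1.2.1, z.1.2.1, z.1.2.2 - z.2.2.2),
      (z.2.1 + z.1.1, z.2.2.1 + z.1.2.1, z.2.2.2)) := by
  rw [MeasurableEquiv.symm_apply_eq, mapV_apply]
  ext <;> simp
  ring

theorem continuous_mapV (J : Matrix (Fin n) (Fin n) ℝ) : Continuous (mapV J) := by
  rw [show ⇑(mapV J) = _ from funext (mapV_apply J)]
  fun_prop

theorem continuous_mapV_symm (J : Matrix (Fin n) (Fin n) ℝ) : Continuous (mapV J).symm := by
  rw [show ⇑(mapV J).symm = _ from funext (mapV_symm_apply J)]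
  fun_prop

theorem coeFn_VTheta (J : Matrix (Fin n) (Fin n) ℝ) (κ : L2 (X n × X n)) :
    VTheta J κ =ᵐ[volume] fun z => (Theta J (mapV J z) : ℂ) * κ (mapV J z) := by
  set g := mulU (Theta J) (measurable_Theta J) κ
  set gY := opY₁₃ n g
  set gZ := (opZ₁₂ J)⁻¹ gY
  set gX := opX₂₄ n gZ
  have e : VTheta J κ = opZ₁₂ J gX := rfl
  have h1 : opZ₁₂ J gX =ᵐ[volume] fun z => gX (mapZ₁₂ J z) := coeFn_compU _ _ gX
  have h2 : gX =ᵐ[volume] fun z => gZ (mapX₂₄ n z) := coeFn_compU _ _ gZ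
  have h3 : gZ =ᵐ[volume] fun z => gY ((mapZ₁₂ J).symm z) := coeFn_compU_inv _ _ gY
  have h4 : gY =ᵐ[volume] fun z => g (mapY₁₃ n z) := coeFn_compU _ _ g
  have h5 : g =ᵐ[volume] fun z => (Theta J z : ℂ) * κ z := coeFn_mulU _ κ
  have q1 := measurePreserving_mapZ₁₂ J
  have q2 := (measurePreserving_mapX₂₄ n).comp q1
  have q3 := (q1.symm _).comp q2
  rw [e]
  filter_upwards [h1, q1.quasiMeasurePreserving.ae h2, q2.quasiMeasurePreserving.ae h3,
    q3.quasiMeasurePreserving.ae h4, (measurePreserving_mapV J).quasiMeasurePreserving.ae h5]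
    with z a1 a2 a3 a4 a5
  rw [a1, a2]
  refine (a3.trans a4).trans a5

theorem coeFn_VTheta_symm (J : Matrix (Fin n) (Fin n) ℝ) (κ : L2 (X n × X n)) :
    (VTheta J).symm κ =ᵐ[volume] fun z => (Theta J z : ℂ)⁻¹ * κ ((mapV J).symm z) := by
  have h := coeFn_VTheta J ((VTheta J).symm κ)
  rw [LinearIsometryEquiv.apply_symm_apply] at h
  filter_upwards [((measurePreserving_mapV J).symm _).quasiMeasurePreserving.ae h] with z hz
  rw [hz, MeasurableEquiv.apply_symm_apply, inv_mul_cancel_left₀ (Circle.coe_ne_zero _)]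

/-! ### The operator `T ⊗ 1` acts in the first variable -/

section Ampl
variable {α : Type} [MeasureSpace α] [SigmaFinite (volume : Measure α)]

theorem eq_of_forall_inner_tmul {a b : L2 (α × α)}
    (h : ∀ f g : L2 α, inner ℂ (tmul f g) a = inner ℂ (tmul f g) b) : a = b := by
  refine (denseRange_tensorToL2 α).eq_of_inner_right (𝕜 := ℂ) ?_
  intro t
  induction t with
  | zero => simp
  | add s t hs ht => rw [map_add, inner_add_left, inner_add_left, hs, ht]
  | tmul f g => exact h f g

theorem continuousLinearMap_ext_tmul {F : Type*} [NormedAddCommGroup F] [NormedSpace ℂ F]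
    {A B : L2 (α × α) →L[ℂ] F} (h : ∀ f g : L2 α, A (tmul f g) = B (tmul f g)) : A = B := by
  apply DFunLike.coe_injective
  refine (denseRange_tensorToL2 α).equalizer A.continuous B.continuous ?_
  funext t
  simp only [Function.comp_apply]
  induction t with
  | zero => simp
  | add s t hs ht => rw [map_add, map_add, map_add, hs, ht]
  | tmul f g => exact h f g

theorem inner_tmul_ampl (T : L2 α →L[ℂ] L2 α) (f g : L2 α) (κ : L2 (α × α)) :
    inner ℂ (tmul f g) (ampl T κ) = inner ℂ (tmul (T.adjoint f) g) κ := by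
  have h : (innerSL ℂ (tmul f g)).comp (ampl T) = innerSL ℂ (tmul (T.adjoint f) g) := by
    refine continuousLinearMap_ext_tmul fun a b => ?_
    simp [ampl_tmul, inner_tmul, ContinuousLinearMap.adjoint_inner_left]
  exact congrArg (fun A => A κ) h

theorem inner_tmul_eq_integral (f g : L2 α) (κ : L2 (α × α)) :
    inner ℂ (tmul f g) κ =
      ∫ u', starRingEnd ℂ (g u') * ∫ u, starRingEnd ℂ (f u) * κ (u, u') := by
  have hint := L2.integrable_inner (𝕜 := ℂ) (tmul f g) κ
  have e : (fun z : α × α => inner ℂ (tmul f g z) (κ z)) =ᵐ[volume] fun z =>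
      starRingEnd ℂ (g z.2) * (starRingEnd ℂ (f z.1) * κ z) := by
    filter_upwards [coeFn_tmul f g] with z hz
    simp only [hz, RCLike.inner_apply, map_mul]
    ring
  rw [L2.inner_def, integral_congr_ae e]
  refine (integral_prod_symm _ (hint.congr e)).trans ?_
  refine integral_congr_ae (Filter.Eventually.of_forall fun u' => ?_)
  exact integral_const_mul (starRingEnd ℂ (g u')) _

theorem ae_memLp_slice (κ : L2 (α × α)) : ∀ᵐ u', MemLp (fun u => κ (u, u')) 2 volume := by
  have h := (memLp_two_iff_integrable_sq_norm (Lp.aestronglyMeasurable κ)).1 (Lp.memLp κ)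
  have hm : Measurable κ := (Lp.stronglyMeasurable κ).measurable
  filter_upwards [Integrable.prod_left_ae (μ := (volume : Measure α)) h] with u' hu'
  have : AEStronglyMeasurable (fun u => κ (u, u')) volume :=
    (hm.comp measurable_prodMk_right).aestronglyMeasurable
  exact (memLp_two_iff_integrable_sq_norm this).2 hu'

/-- If `η(·, u') = T κ(·, u')` for almost all `u'`, then `η = (T ⊗ 1) κ`. -/
theorem eq_ampl_of_ae_slice {T : L2 α →L[ℂ] L2 α} {κ η : L2 (α × α)}
    (h : ∀ᵐ u', ∀ hu' : MemLp (fun u => κ (u, u')) 2 volume,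
      T hu'.toLp =ᵐ[volume] fun u => η (u, u')) : η = ampl T κ := by
  refine eq_of_forall_inner_tmul fun f g => ?_
  rw [inner_tmul_ampl, inner_tmul_eq_integral, inner_tmul_eq_integral]
  refine integral_congr_ae ?_
  filter_upwards [h, ae_memLp_slice κ] with u' h1 h2
  have e1 : ∫ u, starRingEnd ℂ (f u) * η (u, u') = inner ℂ f (T h2.toLp) := by
    rw [L2.inner_def]
    refine integral_congr_ae ?_
    filter_upwards [h1 h2] with u hu
    rw [hu, RCLike.inner_apply, mul_comm]
  have e2 : ∫ u, starRingEnd ℂ (T.adjoint f u) * κ (u, u') = inner ℂ (T.adjoint f) h2.toLp := by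
    rw [L2.inner_def]
    refine integral_congr_ae ?_
    filter_upwards [h2.coeFn_toLp] with u hu
    rw [hu, RCLike.inner_apply, mul_comm]
  rw [e1, e2, ContinuousLinearMap.adjoint_inner_left]

end Ampl

/-- If `L_φ` is bounded, its integral formula in the first variable computes `L_φ ⊗ 1`. -/
theorem IsRegAmp.eq_ampl {J : Matrix (Fin n) (Fin n) ℝ} {φ : X n → ℂ} {T : L2 (X n) →L[ℂ] L2 (X n)}
    (hT : IsReg J φ T) {κ η : L2 (X n × X n)} (h : IsRegAmp J φ κ η) : η = ampl T κ := by
  refine eq_ampl_of_ae_slice ?_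
  have h' := Measure.ae_ae_of_ae_prod
    ((Measure.measurePreserving_swap (μ := (volume : Measure (X n)))
      (ν := (volume : Measure (X n)))).quasiMeasurePreserving.ae h)
  filter_upwards [h'] with u' hu' hm
  have c := twInt_congr_ae (J := J) (f := pft φ) hm.coeFn_toLp
  filter_upwards [hT hm.toLp, hu', c] with u h1 h2 h3
  rw [h1.2]
  refine (integral_congr_ae h3).trans h2.2.symm

/-! ### Restriction to a subspace and integration along the dual fibres -/

/-- The Euclidean coordinates on `(ℝⁿ × ℝⁿ) × (ℝⁿ × ℝⁿ)`. -/
def coordWW (n : ℕ) := prodCoord (coordW n) (coordW n)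

theorem measurePreserving_coordWW (n : ℕ) : MeasurePreserving (coordWW n) :=
  measurePreserving_prodCoord (measurePreserving_coordW n) (measurePreserving_coordW n)

theorem ft_coordWW (g : (V n × V n) × (V n × V n) → ℂ) (k : (V n × V n) × (V n × V n)) :
    ft (coordWW n) g k = ∫ w, (pairing k.1 w.1 : ℂ) * pairing k.2 w.2 * g w := by
  simp only [ft, coordWW, inner_prodCoord, AddChar.map_add_eq_mul, fourierChar_coordW,
    Circle.coe_mul]

theorem pairing_add_right (k w w' : V n × V n) :
    pairing k (w + w') = pairing k w * pairing k w' := by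
  simp only [pairing, Prod.fst_add, Prod.snd_add, dotProduct_add, ← AddChar.map_add_eq_mul]
  congr 1; ring

theorem pairing_add_left (k k' w : V n × V n) :
    pairing (k + k') w = pairing k w * pairing k' w := by
  rw [pairing_comm, pairing_add_right, pairing_comm w k, pairing_comm w k']

theorem continuous_pairing :
    Continuous fun p : (V n × V n) × (V n × V n) => (pairing p.1 p.2 : ℂ) := by
  unfold pairing
  have := Real.continuous_fourierChar
  fun_prop

theorem integral_mul_ft_coordW {φ h : V n × V n → ℂ} (hφ : Integrable φ) (hh : Integrable h) :
    ∫ k, φ k * ft (coordW n) h k = ∫ w, (∫ k, φ k * pairing k w) * h w := by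
  have hint : Integrable (fun p : (V n × V n) × (V n × V n) =>
      (pairing p.1 p.2 : ℂ) * (φ p.1 * h p.2))
      ((volume : Measure (V n × V n)).prod (volume : Measure (V n × V n))) := by
    refine (hφ.mul_prod hh).bdd_mul (c := 1) continuous_pairing.aestronglyMeasurable ?_
    exact Filter.Eventually.of_forall fun p => (Circle.norm_coe _).le
  have hs := integral_integral_swap (f := fun k w => (pairing k w : ℂ) * (φ k * h w)) hint
  calc _ = ∫ k, ∫ w, (pairing k w : ℂ) * (φ k * h w) := by
        refine integral_congr_ae (Filter.Eventually.of_forall fun k => ?_)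
        simp only [ft_coordW]
        rw [← integral_const_mul]
        congr 1 with w; ring
    _ = _ := by
        rw [hs]
        refine integral_congr_ae (Filter.Eventually.of_forall fun w => ?_)
        simp only
        rw [← integral_mul_const]
        congr 1 with k; ring

instance isAddHaarMeasure_volume_prod (n : ℕ) :
    (volume : Measure (V n × V n)).IsAddHaarMeasure :=
  Measure.prod.instIsAddHaarMeasure _ _

/-- If `S'` is the transpose of `S`, then integrating the Fourier transform of `g` against the
function `k ↦ φ(k₂ + S' k₁)`, which is constant along a family of parallel subspaces, amounts to
integrating the restriction of `g` to the graph `{(S w, w)}` against the Fourier transform of `φ`.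
In the coordinates `(w₁ - S w₂, w₂)` this is Fourier inversion at `0` in the first variable. -/
theorem integral_mul_ft_coordWW {g : (V n × V n) × (V n × V n) → ℂ} (hs : ContDiff ℝ ∞ g)
    (hc : HasCompactSupport g) {φ : V n × V n → ℂ} (hφ : Continuous φ) (hφc : HasCompactSupport φ)
    (S : V n × V n →L[ℝ] V n × V n) {S' : V n × V n → V n × V n} (hS' : Continuous S')
    (hSS : ∀ k w, pairing k (S w) = pairing (S' k) w) :
    ∫ k, φ (k.2 + S' k.1) * ft (coordWW n) g k = ∫ w, (∫ k, φ k * pairing k w) * g (S w, w) := by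
  let sh := shearL S S.continuous.measurable
  have hsh : MeasurePreserving sh := shearL_mp _ _
  let g' : (V n × V n) × (V n × V n) → ℂ := fun w => g (w.1 + S w.2, w.2)
  have hs' : ContDiff ℝ ∞ g' :=
    hs.comp ((contDiff_fst.add (S.contDiff.comp contDiff_snd)).prodMk contDiff_snd)
  have hc' : HasCompactSupport g' := by
    refine HasCompactSupport.intro
      (K := (fun w : (V n × V n) × (V n × V n) => (w.1 - S w.2, w.2)) '' tsupport g)
      (hc.isCompact.image (by fun_prop)) fun w hw => ?_
    refine image_eq_zero_of_notMem_tsupport (f := g) fun h => hw ⟨_, h, ?_⟩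
    simp
  have hG' := integrable_ft (measurePreserving_coordWW n) hs' hc'
  have hGG : ∀ k, ft (coordWW n) g k = ft (coordWW n) g' (k.1, k.2 + S' k.1) := by
    intro k
    rw [ft_coordWW, ft_coordWW, ← hsh.integral_comp sh.measurableEmbedding]
    refine integral_congr_ae (Filter.Eventually.of_forall fun w => ?_)
    have : sh w = (w.1 + S w.2, w.2) := rfl
    simp only [this, pairing_add_right, pairing_add_left, hSS, Circle.coe_mul, g']
    ring
  let sr := shearR S' hS'.measurable
  have hsr : MeasurePreserving sr := shearR_mp _ _
  obtain ⟨C, hC⟩ := hφ.bounded_above_of_compact_support hφc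
  have hint : Integrable (fun q : (V n × V n) × (V n × V n) => φ q.2 * ft (coordWW n) g' q)
      ((volume : Measure (V n × V n)).prod (volume : Measure (V n × V n))) :=
    Integrable.bdd_mul (c := C) hG' (by fun_prop) (Filter.Eventually.of_forall fun q => hC _)
  have hinv := ae_partial_fourier_inversion (e₁ := coordW n) (e₂ := coordW n)
    (measurePreserving_coordW n) hs'.continuous hc' hG'
  have hh : Continuous fun w => g (S w, w) := by
    have := hs.continuous
    fun_prop
  have hhc : HasCompactSupport fun w => g (S w, w) := by
    refine HasCompactSupport.intro (hc.isCompact.image continuous_snd) fun w hw => ?_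
    exact image_eq_zero_of_notMem_tsupport (f := g) fun h => hw ⟨_, h, rfl⟩
  calc ∫ k, φ (k.2 + S' k.1) * ft (coordWW n) g k
      = ∫ k, (fun q : (V n × V n) × (V n × V n) => φ q.2 * ft (coordWW n) g' q) (sr k) := by
        simp only [hGG]; rfl
    _ = ∫ q : (V n × V n) × (V n × V n), φ q.2 * ft (coordWW n) g' q :=
        hsr.integral_comp sr.measurableEmbedding
          (fun q : (V n × V n) × (V n × V n) => φ q.2 * ft (coordWW n) g' q)
    _ = ∫ k₂, ∫ k₁, φ k₂ * ft (coordWW n) g' (k₁, k₂) := integral_prod_symm _ hint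
    _ = ∫ k₂, φ k₂ * ft (coordW n) (fun w => g (S w, w)) k₂ := by
        refine integral_congr_ae ?_
        filter_upwards [hinv] with k₂ hk₂
        have := hk₂.2 0
        simp only [g', zero_add, map_zero, inner_zero_left, neg_zero, AddChar.map_zero_eq_one,
          Circle.coe_one, one_mul] at this
        rw [integral_const_mul, this]
        rfl
    _ = _ := integral_mul_ft_coordW (hφ.integrable_of_hasCompactSupport hφc)
        (hh.integrable_of_hasCompactSupport hhc)

/-! ### Partial Fourier transforms of functions on the group -/

theorem hasCompactSupport_fibre {φ : X n → ℂ} (hφc : HasCompactSupport φ) (r : ℝ) :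
    HasCompactSupport fun k : V n × V n => φ (k.1, k.2, r) := by
  refine HasCompactSupport.intro
    (hφc.isCompact.image (f := fun u : X n => (u.1, u.2.1)) (by fun_prop)) fun k hk => ?_
  exact image_eq_zero_of_notMem_tsupport (f := φ) fun h => hk ⟨_, h, rfl⟩

theorem continuous_pft {φ : X n → ℂ} (hφ : Continuous φ) (hφc : HasCompactSupport φ) :
    Continuous fun p : (V n × V n) × ℝ => pft φ p.1 p.2 := by
  unfold pft
  refine continuous_integral_of_forall_notMem_eq_zero ?_
    (hφc.isCompact.image (f := fun u : X n => (u.1, u.2.1)) (by fun_prop)) fun p k hk => ?_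
  · have := continuous_pairing (n := n)
    exact (hφ.comp (f := fun q : ((V n × V n) × ℝ) × (V n × V n) => (q.2.1, q.2.2, q.1.2))
      (by fun_prop)).mul (this.comp
        (f := fun q : ((V n × V n) × ℝ) × (V n × V n) => (q.2, q.1.1)) (by fun_prop))
  · exact mul_eq_zero_of_left (image_eq_zero_of_notMem_tsupport (f := φ) fun h => hk ⟨_, h, rfl⟩) _

theorem exists_lintegral_enorm_sq_pft_le {φ : X n → ℂ} (hφ : Continuous φ)
    (hφc : HasCompactSupport φ) : ∃ P : ℝ≥0, ∀ r, ∫⁻ w, ‖pft φ w r‖ₑ ^ 2 ≤ P := by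
  obtain ⟨C, hC⟩ := hφ.bounded_above_of_compact_support hφc
  have hK := hφc.isCompact.image (f := fun u : X n => (u.1, u.2.1)) (by fun_prop)
  have hfin : ENNReal.ofReal (C + 1) ^ 2 *
      volume ((fun u : X n => (u.1, u.2.1)) '' tsupport φ) ≠ ⊤ :=
    ENNReal.mul_ne_top (by finiteness) hK.measure_lt_top.ne
  refine ⟨(ENNReal.ofReal (C + 1) ^ 2 *
      volume ((fun u : X n => (u.1, u.2.1)) '' tsupport φ)).toNNReal, fun r => ?_⟩
  rw [ENNReal.coe_toNNReal hfin]
  simp only [pft_eq_ft]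
  refine lintegral_enorm_sq_ft_le (measurePreserving_coordW n) (by fun_prop)
    (hasCompactSupport_fibre hφc r) (fun k => hC _) hK.measurableSet fun k hk => ?_
  exact image_eq_zero_of_notMem_tsupport (f := φ) fun h => hk ⟨_, h, rfl⟩

/-! ### The cocycle identity -/

theorem contDiff_fourierChar_coe : ContDiff ℝ ∞ fun t : ℝ => (Real.fourierChar t : ℂ) := by
  simp only [Real.fourierChar_apply]
  have := Complex.ofRealCLM.contDiff (n := ∞)
  exact Complex.contDiff_exp.comp
    ((Complex.ofRealCLM.contDiff.comp (contDiff_const.mul contDiff_id)).mul contDiff_const)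

theorem contDiff_dotProduct {E : Type*} [NormedAddCommGroup E] [NormedSpace ℝ E] {f g : E → V n}
    (hf : ContDiff ℝ ∞ f) (hg : ContDiff ℝ ∞ g) : ContDiff ℝ ∞ fun x => f x ⬝ᵥ g x := by
  unfold dotProduct
  exact ContDiff.sum fun i _ => (contDiff_pi.1 hf i).mul (contDiff_pi.1 hg i)

theorem contDiff_mulVec {E : Type*} [NormedAddCommGroup E] [NormedSpace ℝ E] {f : E → V n}
    (J : Matrix (Fin n) (Fin n) ℝ) (hf : ContDiff ℝ ∞ f) : ContDiff ℝ ∞ fun x => J.mulVec (f x) :=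
  (LinearMap.toContinuousLinearMap (Matrix.mulVecLin J)).contDiff.comp hf

theorem contDiff_sigma {E : Type*} [NormedAddCommGroup E] [NormedSpace ℝ E] {f g : E → V n × V n}
    (J : Matrix (Fin n) (Fin n) ℝ) (r : ℝ) (hf : ContDiff ℝ ∞ f) (hg : ContDiff ℝ ∞ g) :
    ContDiff ℝ ∞ fun x => (sigma J r (f x) (g x) : ℂ) := by
  simp only [sigma, Circle.coe_mul]
  refine (contDiff_fourierChar_coe.comp ?_).mul (contDiff_fourierChar_coe.comp ?_)
  · exact (contDiff_const.mul (contDiff_dotProduct (contDiff_mulVec J hf.snd) hg.snd)).neg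
  · exact (contDiff_const.mul (contDiff_dotProduct hf.fst hg.snd)).neg

/-- The factor of the integrand of `regTensorKernel J ζ z` that does not depend on the frequency. -/
def twTensor (J : Matrix (Fin n) (Fin n) ℝ) (ζ : X n × X n → ℂ) (z : X n × X n)
    (w : (V n × V n) × (V n × V n)) : ℂ :=
  sigma J z.1.2.2 w.1 (z.1.1 - w.1.1, z.1.2.1 - w.1.2) *
    sigma J z.2.2.2 w.2 (z.2.1 - w.2.1, z.2.2.1 - w.2.2) * ζ (tr z.1 w.1, tr z.2 w.2)

theorem regTensorKernel_eq_ft (J : Matrix (Fin n) (Fin n) ℝ) (ζ : X n × X n → ℂ)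
    (z : X n × X n) : regTensorKernel J ζ z = ft (coordWW n) (twTensor J ζ z) := by
  funext k
  rw [ft_coordWW]
  unfold regTensorKernel
  congr 1 with w
  simp only [twTensor, tr]
  ring

theorem contDiff_twTensor (J : Matrix (Fin n) (Fin n) ℝ) {ζ : X n × X n → ℂ}
    (hζ : ContDiff ℝ ∞ ζ) (z : X n × X n) : ContDiff ℝ ∞ (twTensor J ζ z) := by
  unfold twTensor tr
  refine ((contDiff_sigma J _ contDiff_fst ?_).mul (contDiff_sigma J _ contDiff_snd ?_)).mul
    (hζ.comp ?_)
  all_goals fun_prop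

theorem hasCompactSupport_twTensor (J : Matrix (Fin n) (Fin n) ℝ) {ζ : X n × X n → ℂ}
    (hζ : HasCompactSupport ζ) (z : X n × X n) : HasCompactSupport (twTensor J ζ z) := by
  refine HasCompactSupport.intro (hζ.isCompact.image
    (f := fun v : X n × X n => ((z.1.1 - v.1.1, z.1.2.1 - v.1.2.1),
      (z.2.1 - v.2.1, z.2.2.1 - v.2.2.1))) (by fun_prop)) fun w hw => ?_
  refine mul_eq_zero_of_right _ (image_eq_zero_of_notMem_tsupport fun h => hw ⟨_, h, ?_⟩)
  simp [tr]

/-- The linear map `(x, y) ↦ (x + r ∑ J_ij y_j x_i, y)`. -/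
def shearJ (J : Matrix (Fin n) (Fin n) ℝ) (r : ℝ) : V n × V n →L[ℝ] V n × V n :=
  LinearMap.toContinuousLinearMap
    ((LinearMap.fst ℝ (V n) (V n) + r • (Matrix.mulVecLin J).comp (LinearMap.snd ℝ (V n) (V n))).prod
      (LinearMap.snd ℝ (V n) (V n)))

theorem shearJ_apply (J : Matrix (Fin n) (Fin n) ℝ) (r : ℝ) (w : V n × V n) :
    shearJ J r w = (w.1 + r • J.mulVec w.2, w.2) := rfl

theorem pairing_shearJ (J : Matrix (Fin n) (Fin n) ℝ) (r : ℝ) (k w : V n × V n) :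
    pairing k (shearJ J r w) = pairing (k.1, k.2 + r • Matrix.vecMul k.1 J) w := by
  simp only [pairing, shearJ_apply, dotProduct_add, add_dotProduct, dotProduct_smul, smul_dotProduct,
    Matrix.dotProduct_mulVec]
  congr 1; ring

theorem mulVec_dotProduct_skew {J : Matrix (Fin n) (Fin n) ℝ} (hJ : J.transpose = -J) (a b : V n) :
    J.mulVec a ⬝ᵥ b = -(J.mulVec b ⬝ᵥ a) := by
  rw [dotProduct_comm, Matrix.dotProduct_mulVec, ← Matrix.mulVec_transpose, hJ, Matrix.neg_mulVec,
    neg_dotProduct]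

/-- The cocycle identity behind `Δ(L_φ) = (L ⊗ L)_{Δ(φ)}`: conjugation by `V_Θ` turns the cocycle
`σ^{r + r'}` into the product of the cocycles `σ^r` and `σ^{r'}`. -/
theorem Theta_mul_sigma_mul_inv {J : Matrix (Fin n) (Fin n) ℝ} (hJ : J.transpose = -J)
    (z : X n × X n) (w : V n × V n) :
    Theta J (mapV J z) * sigma J (mapV J z).1.2.2 w
        ((mapV J z).1.1 - w.1, (mapV J z).1.2.1 - w.2) *
      (Theta J (tr (mapV J z).1 w, (mapV J z).2))⁻¹ =
    sigma J z.1.2.2 (shearJ J z.2.2.2 w)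
        (z.1.1 - (shearJ J z.2.2.2 w).1, z.1.2.1 - (shearJ J z.2.2.2 w).2) *
      sigma J z.2.2.2 w (z.2.1 - w.1, z.2.2.1 - w.2) := by
  obtain ⟨⟨x, y, r⟩, ⟨x', y', r'⟩⟩ := z
  obtain ⟨a, b⟩ := w
  simp only [mapV_apply, Theta, sigma, tr, shearJ_apply, ← AddChar.map_add_eq_mul,
    ← AddChar.map_neg_eq_inv]
  congr 1
  simp only [Matrix.mulVec_sub, dotProduct_sub,
    sub_dotProduct, add_dotProduct, smul_dotProduct, smul_eq_mul]
  have h1 := mulVec_dotProduct_skew hJ b b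
  have h2 := mulVec_dotProduct_skew hJ y y
  have h3 := mulVec_dotProduct_skew hJ y b
  have h1' : J.mulVec b ⬝ᵥ b = 0 := by linarith
  have h2' : J.mulVec y ⬝ᵥ y = 0 := by linarith
  simp only [h1', h2']
  ring

/-! ### The operator `V_Θ (L_φ ⊗ 1) V_Θ*` on test functions -/

/-- The function `V_Θ* ζ`, defined pointwise. -/
def pullTheta (J : Matrix (Fin n) (Fin n) ℝ) (ζ : X n × X n → ℂ) (z : X n × X n) : ℂ :=
  ((Theta J z)⁻¹ : Circle) * ζ ((mapV J).symm z)

/-- The integrand of `V_Θ (L_φ ⊗ 1) V_Θ* ζ` at `z` is the product of `φ^∨` at `r + r'` with the integrand of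
`regTensorKernel J ζ z` restricted to the graph of the shear. -/
theorem Theta_mul_twInt_pullTheta {J : Matrix (Fin n) (Fin n) ℝ} (hJ : J.transpose = -J)
    (φ : X n → ℂ) (ζ : X n × X n → ℂ) (z : X n × X n) (w : V n × V n) :
    (Theta J (mapV J z) : ℂ) *
      twInt J (pft φ) (fun v => pullTheta J ζ (v, (mapV J z).2)) (mapV J z).1 w =
    pft φ w (z.1.2.2 + z.2.2.2) * twTensor J ζ z (shearJ J z.2.2.2 w, w) := by
  have h := congrArg (fun c : Circle => (c : ℂ)) (Theta_mul_sigma_mul_inv hJ z w)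
  simp only [Circle.coe_mul] at h
  have hz : (mapV J).symm (tr (mapV J z).1 w, (mapV J z).2) =
      (tr z.1 (shearJ J z.2.2.2 w), tr z.2 w) := by
    rw [mapV_symm_apply]
    simp only [mapV_apply, tr, shearJ_apply, Matrix.mulVec_sub, smul_sub]
    ext <;> simp
    · ring
    · ring
  have hr : (mapV J z).1.2.2 = z.1.2.2 + z.2.2.2 := by rw [mapV_apply]
  simp only [twInt, pullTheta, twTensor, hz]
  rw [← h, hr]
  ring

theorem continuous_Theta (J : Matrix (Fin n) (Fin n) ℝ) : Continuous (Theta J) := by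
  unfold Theta
  have := Real.continuous_fourierChar
  fun_prop

theorem continuous_pullTheta (J : Matrix (Fin n) (Fin n) ℝ) {ζ : X n × X n → ℂ}
    (hζ : Continuous ζ) : Continuous (pullTheta J ζ) := by
  have := continuous_Theta J
  have := continuous_mapV_symm J
  unfold pullTheta
  fun_prop

theorem hasCompactSupport_pullTheta (J : Matrix (Fin n) (Fin n) ℝ) {ζ : X n × X n → ℂ}
    (hζ : HasCompactSupport ζ) : HasCompactSupport (pullTheta J ζ) := by
  refine HasCompactSupport.intro (hζ.isCompact.image (continuous_mapV J)) fun z hz => ?_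
  exact mul_eq_zero_of_right _ (image_eq_zero_of_notMem_tsupport fun h => hz ⟨_, h, by simp⟩)

theorem continuous_twInt_pair (J : Matrix (Fin n) (Fin n) ℝ) {φ : X n → ℂ} (hφ : Continuous φ)
    (hφc : HasCompactSupport φ) {κ : X n × X n → ℂ} (hκ : Continuous κ) :
    Continuous fun p : (X n × X n) × (V n × V n) =>
      twInt J (pft φ) (fun v => κ (v, p.1.2)) p.1.1 p.2 := by
  unfold twInt
  refine (((continuous_pft hφ hφc).comp (f := fun p : (X n × X n) × (V n × V n) =>
    (p.2, p.1.1.2.2)) (by fun_prop)).mul ((continuous_sigma J).comp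
    (f := fun p : (X n × X n) × (V n × V n) =>
      (p.1.1.2.2, p.2, (p.1.1.1 - p.2.1, p.1.1.2.1 - p.2.2))) (by fun_prop))).mul
    (hκ.comp (f := fun p : (X n × X n) × (V n × V n) => (tr p.1.1 p.2, p.1.2)) ?_)
  unfold tr
  fun_prop

theorem hasCompactSupport_twInt (J : Matrix (Fin n) (Fin n) ℝ) (f : V n × V n → ℝ → ℂ)
    {κ : X n × X n → ℂ} (hκ : HasCompactSupport κ) (z : X n × X n) :
    HasCompactSupport fun w => twInt J f (fun v => κ (v, z.2)) z.1 w := by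
  refine HasCompactSupport.intro (hκ.isCompact.image
    (f := fun v : X n × X n => (z.1.1 - v.1.1, z.1.2.1 - v.1.2.1)) (by fun_prop)) fun w hw => ?_
  refine mul_eq_zero_of_right _ (image_eq_zero_of_notMem_tsupport (f := κ) fun h => hw ⟨_, h, ?_⟩)
  simp [tr]

theorem integrable_twInt_pair (J : Matrix (Fin n) (Fin n) ℝ) {φ : X n → ℂ} (hφ : Continuous φ)
    (hφc : HasCompactSupport φ) {κ : X n × X n → ℂ} (hκ : Continuous κ)
    (hκc : HasCompactSupport κ) (z : X n × X n) :
    Integrable (twInt J (pft φ) (fun v => κ (v, z.2)) z.1) :=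
  ((continuous_twInt_pair J hφ hφc hκ).comp
    (Continuous.prodMk_right z)).integrable_of_hasCompactSupport
      (hasCompactSupport_twInt J _ hκc z)

/-- For a continuous `φ` with compact support, `L_φ` may be unbounded, but `L_φ ⊗ 1` maps continuous
functions of compact support into `L²`. By Plancherel's theorem `φ^∨` is square integrable over the
fibres `r = const`, and the convolution of a function in `L²` with one in `L¹` is in `L²`. -/
theorem memLp_integral_twInt_pair (J : Matrix (Fin n) (Fin n) ℝ) {φ : X n → ℂ} (hφ : Continuous φ)
    (hφc : HasCompactSupport φ) {κ : X n × X n → ℂ} (hκ : Continuous κ)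
    (hκc : HasCompactSupport κ) :
    MemLp (fun z : X n × X n => ∫ w, twInt J (pft φ) (fun v => κ (v, z.2)) z.1 w) 2 volume := by
  have hcont := continuous_twInt_pair J hφ hφc hκ
  have hmeas : StronglyMeasurable
      fun z : X n × X n => ∫ w, twInt J (pft φ) (fun v => κ (v, z.2)) z.1 w :=
    hcont.stronglyMeasurable.integral_prod_right'
  refine ⟨hmeas.aestronglyMeasurable, ?_⟩
  obtain ⟨D, hD⟩ := hκ.bounded_above_of_compact_support hκc
  obtain ⟨P, hP⟩ := exists_lintegral_enorm_sq_pft_le hφ hφc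
  set A := Prod.fst '' tsupport κ with hA
  set B := Prod.snd '' tsupport κ with hB
  have cA : IsCompact A := hκc.isCompact.image continuous_fst
  have cB : IsCompact B := hκc.isCompact.image continuous_snd
  set AW := (fun u : X n => (u.1, u.2.1)) '' A with hAW
  have cAW : IsCompact AW := cA.image (by fun_prop)
  have mA : Measurable (A.indicator (1 : X n → ENNReal)) :=
    measurable_one.indicator cA.measurableSet
  have mpft : Measurable fun p : (V n × V n) × ℝ => ‖pft φ p.1 p.2‖ₑ :=
    (continuous_pft hφ hφc).measurable.enorm
  have hκle : ∀ u u', ‖κ (u, u')‖ₑ ≤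
      ENNReal.ofReal D * B.indicator 1 u' * A.indicator (1 : X n → ENNReal) u := by
    intro u u'
    by_cases h : (u, u') ∈ tsupport κ
    · rw [Set.indicator_of_mem (show u ∈ A from ⟨_, h, rfl⟩),
        Set.indicator_of_mem (show u' ∈ B from ⟨_, h, rfl⟩), ← ofReal_norm]
      simpa using ENNReal.ofReal_le_ofReal (hD _)
    · simp [image_eq_zero_of_notMem_tsupport h]
  -- a fibre of `A`, reflected and translated, has at most the measure of the projection of `A`
  have h1 : ∀ u : X n, ∫⁻ w, A.indicator (1 : X n → ENNReal) (tr u w) ≤ volume AW := by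
    intro u
    have : (volume : Measure (V n × V n)).IsNegInvariant :=
      ⟨((Measure.measurePreserving_neg (volume : Measure (V n))).prod
        (Measure.measurePreserving_neg (volume : Measure (V n)))).map_eq⟩
    calc ∫⁻ w, A.indicator (1 : X n → ENNReal) (tr u w)
        ≤ ∫⁻ w, AW.indicator (1 : V n × V n → ENNReal) ((u.1, u.2.1) - w) := by
          refine lintegral_mono fun w => ?_
          by_cases h : tr u w ∈ A
          · have h' : (u.1, u.2.1) - w ∈ AW := ⟨_, h, rfl⟩
            simp [h, h']
          · simp [h]
      _ = ∫⁻ w, AW.indicator (1 : V n × V n → ENNReal) w :=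
          lintegral_sub_left_eq_self _ _
      _ = volume AW := lintegral_indicator_one cAW.measurableSet
  -- the Cauchy–Schwarz inequality, with the indicator function of `A` as density
  have h2 : ∀ z : X n × X n, ‖∫ w, twInt J (pft φ) (fun v => κ (v, z.2)) z.1 w‖ₑ ^ 2 ≤
      ENNReal.ofReal D ^ 2 * B.indicator 1 z.2 * (volume AW *
        ∫⁻ w, ‖pft φ w z.1.2.2‖ₑ ^ 2 * A.indicator (1 : X n → ENNReal) (tr z.1 w)) := by
    intro z
    have m1 : Measurable fun w => A.indicator (1 : X n → ENNReal) (tr z.1 w) :=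
      mA.comp (continuous_tr.comp (Continuous.prodMk_right z.1)).measurable
    have m2 : Measurable fun w => ‖pft φ w z.1.2.2‖ₑ := mpft.comp measurable_prodMk_right
    have e : B.indicator (1 : X n → ENNReal) z.2 = B.indicator 1 z.2 ^ 2 := by
      by_cases h : z.2 ∈ B <;> simp [h]
    calc _ ≤ (∫⁻ w, (ENNReal.ofReal D * B.indicator 1 z.2) *
          (A.indicator (1 : X n → ENNReal) (tr z.1 w) * ‖pft φ w z.1.2.2‖ₑ)) ^ 2 := by
          gcongr
          refine (enorm_integral_le_lintegral_enorm _).trans (lintegral_mono fun w => ?_)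
          rw [enorm_twInt, mul_comm]
          refine (mul_le_mul_left (hκle _ _) _).trans (le_of_eq ?_)
          ring
      _ ≤ (ENNReal.ofReal D * B.indicator 1 z.2) ^ 2 *
          ((∫⁻ w, A.indicator (1 : X n → ENNReal) (tr z.1 w)) *
          ∫⁻ w, A.indicator (1 : X n → ENNReal) (tr z.1 w) * ‖pft φ w z.1.2.2‖ₑ ^ 2) := by
          have m3 : Measurable fun w =>
            A.indicator (1 : X n → ENNReal) (tr z.1 w) * ‖pft φ w z.1.2.2‖ₑ := m1.mul m2
          rw [lintegral_const_mul _ m3, mul_pow]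
          gcongr
          exact lintegral_mul_sq_le m1.aemeasurable m2.aemeasurable
      _ ≤ _ := by
          rw [mul_pow, ← e]
          refine mul_le_mul' le_rfl (mul_le_mul' (h1 _) (le_of_eq ?_))
          simp only [mul_comm]
  have h3 : ∫⁻ u : X n, ∫⁻ w, ‖pft φ w u.2.2‖ₑ ^ 2 * A.indicator (1 : X n → ENNReal) (tr u w) ≤
      P * volume A := by
    rw [lintegral_lintegral_tr (F := fun w r => ‖pft φ w r‖ₑ ^ 2) (mpft.pow_const 2) mA,
      ← lintegral_indicator_one cA.measurableSet, ← lintegral_const_mul _ mA]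
    refine lintegral_mono fun u => ?_
    gcongr
    exact hP _
  have h4 : ∫⁻ z : X n × X n, ‖∫ w, twInt J (pft φ) (fun v => κ (v, z.2)) z.1 w‖ₑ ^ 2 ≤
      ENNReal.ofReal D ^ 2 * (volume AW * (P * volume A)) * volume B := by
    rw [Measure.volume_eq_prod,
      lintegral_prod_symm' _ (hmeas.measurable.enorm.pow_const 2),
      ← lintegral_indicator_one cB.measurableSet, ← lintegral_const_mul _
        (measurable_one.indicator cB.measurableSet)]
    refine lintegral_mono fun u' => ?_
    refine (lintegral_mono fun u => h2 (u, u')).trans ?_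
    dsimp only
    rw [lintegral_const_mul' _ _ (by
        by_cases h : u' ∈ B <;> simp [h]),
      lintegral_const_mul' _ _ cAW.measure_lt_top.ne]
    refine (mul_le_mul_right (mul_le_mul_right h3 _) _).trans (le_of_eq ?_)
    ring
  have h5 := (eLpNorm_two_sq (μ := volume)
    fun z : X n × X n => ∫ w, twInt J (pft φ) (fun v => κ (v, z.2)) z.1 w).trans_le h4
  have h6 : ENNReal.ofReal D ^ 2 * (volume AW * (P * volume A)) * volume B < ⊤ := by
    have := cAW.measure_lt_top (μ := volume)
    have := cA.measure_lt_top (μ := volume)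
    have := cB.measure_lt_top (μ := volume)
    finiteness
  exact (ENNReal.pow_lt_top_iff.1 (h5.trans_lt h6)).resolve_right (by norm_num)

/-! ### The comultiplication -/

theorem continuous_comulFun (J : Matrix (Fin n) (Fin n) ℝ) {φ : X n → ℂ} (hφ : Continuous φ) :
    Continuous (comulFun J φ) := by
  unfold comulFun gmul
  refine hφ.comp ?_
  have : Continuous fun z : X n × X n => Matrix.vecMul z.1.1 J := by fun_prop
  fun_prop

theorem ae_ae_tr_prod {p : X n × X n → Prop} (h : ∀ᵐ z, p z) :
    ∀ᵐ z : X n × X n, ∀ᵐ w : V n × V n, p (tr z.1 w, z.2) := by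
  have hc : Continuous fun q : (V n × V n) × (X n × X n) => (tr q.2.1 q.1, q.2.2) := by
    unfold tr; fun_prop
  have h1 : MeasurePreserving
      (fun q : (V n × V n) × (X n × X n) => (q.1, ((tr q.2.1 q.1, q.2.2) : X n × X n))) :=
    (MeasurePreserving.id (volume : Measure (V n × V n))).skew_product
      (g := fun w z => ((tr z.1 w, z.2) : X n × X n))
      (μc := (volume : Measure (X n × X n))) (μd := (volume : Measure (X n × X n)))
      hc.measurable (Filter.Eventually.of_forall fun w =>
        ((measurePreserving_tr w).prod (MeasurePreserving.id _)).map_eq)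
  have h2 := (Measure.quasiMeasurePreserving_snd.comp h1.quasiMeasurePreserving).comp
    (Measure.measurePreserving_swap (μ := (volume : Measure (X n × X n)))
      (ν := (volume : Measure (V n × V n)))).quasiMeasurePreserving
  exact Measure.ae_ae_of_ae_prod (h2.ae h)

/-- The formula for `(L ⊗ L)_{Δ(φ)} ζ` at the point `z`, in terms of `φ^∨`. -/
theorem integral_comulFun_mul_regTensorKernel (J : Matrix (Fin n) (Fin n) ℝ) {φ : X n → ℂ}
    (hφ : Continuous φ) (hφc : HasCompactSupport φ) {ζ : X n × X n → ℂ} (hζ : ContDiff ℝ ∞ ζ)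
    (hζc : HasCompactSupport ζ) (z : X n × X n) :
    ∫ k : (V n × V n) × (V n × V n), comulFun J φ ((k.1.1, k.1.2, z.1.2.2), (k.2.1, k.2.2, z.2.2.2)) *
        regTensorKernel J ζ z k =
      ∫ w, pft φ w (z.1.2.2 + z.2.2.2) * twTensor J ζ z (shearJ J z.2.2.2 w, w) := by
  have h := integral_mul_ft_coordWW (contDiff_twTensor J hζ z) (hasCompactSupport_twTensor J hζc z)
    (φ := fun k => φ (k.1, k.2, z.1.2.2 + z.2.2.2)) (by fun_prop)
    (hasCompactSupport_fibre hφc _) (shearJ J z.2.2.2)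
    (S' := fun k => (k.1, k.2 + z.2.2.2 • Matrix.vecMul k.1 J)) (by
      have : Continuous fun k : V n × V n => Matrix.vecMul k.1 J := by fun_prop
      fun_prop) (pairing_shearJ J z.2.2.2)
  rw [regTensorKernel_eq_ft]
  refine Eq.trans ?_ h
  congr 1 with k
  simp only [comulFun, gmul, Prod.fst_add, Prod.snd_add]
  rw [add_comm k.1.1 k.2.1, add_comm k.1.2 k.2.2, add_assoc k.2.2]

theorem integrable_comulFun_mul_regTensorKernel (J : Matrix (Fin n) (Fin n) ℝ) {φ : X n → ℂ}
    (hφ : Continuous φ) (hφc : HasCompactSupport φ) {ζ : X n × X n → ℂ} (hζ : ContDiff ℝ ∞ ζ)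
    (hζc : HasCompactSupport ζ) (z : X n × X n) :
    Integrable fun k : (V n × V n) × (V n × V n) =>
      comulFun J φ ((k.1.1, k.1.2, z.1.2.2), (k.2.1, k.2.2, z.2.2.2)) *
        regTensorKernel J ζ z k := by
  obtain ⟨C, hC⟩ := hφ.bounded_above_of_compact_support hφc
  rw [regTensorKernel_eq_ft]
  refine Integrable.bdd_mul (c := C) (integrable_ft (measurePreserving_coordWW n)
    (contDiff_twTensor J hζ z) (hasCompactSupport_twTensor J hζc z)) ?_
    (Filter.Eventually.of_forall fun k => hC _)
  have := continuous_comulFun J hφ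
  exact Continuous.aestronglyMeasurable (by fun_prop)

/-- `V_Θ (L_φ ⊗ 1) V_Θ* ζ = (L ⊗ L)_{Δ(φ)} ζ` for a test function `ζ`. -/
theorem exists_isRegAmp_and_isRegTensorAt {J : Matrix (Fin n) (Fin n) ℝ} (hJ : J.transpose = -J)
    {φ : X n → ℂ} (hφ : Continuous φ) (hφc : HasCompactSupport φ) {ζ : X n × X n → ℂ}
    (hζ : ContDiff ℝ ∞ ζ) (hζc : HasCompactSupport ζ) {κ : L2 (X n × X n)}
    (hκ : κ =ᵐ[volume] ζ) :
    ∃ η, IsRegAmp J φ ((VTheta J).symm κ) η ∧ IsRegTensorAt J (comulFun J φ) ζ (VTheta J η) := by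
  have c0 := continuous_pullTheta J hζ.continuous
  have s0 := hasCompactSupport_pullTheta J hζc
  have hmem := memLp_integral_twInt_pair J hφ hφc c0 s0
  have hpull : (VTheta J).symm κ =ᵐ[volume] pullTheta J ζ := by
    filter_upwards [coeFn_VTheta_symm J κ,
      ((measurePreserving_mapV J).symm _).quasiMeasurePreserving.ae hκ] with z h1 h2
    rw [h1, h2, pullTheta, Circle.coe_inv]
  refine ⟨hmem.toLp, ?_, ?_⟩
  · filter_upwards [ae_ae_tr_prod hpull, hmem.coeFn_toLp] with z h1 h2
    have h3 : twInt J (pft φ) (fun v => pullTheta J ζ (v, z.2)) z.1 =ᵐ[volume]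
        twInt J (pft φ) (fun v => (VTheta J).symm κ (v, z.2)) z.1 := by
      filter_upwards [h1] with w hw
      rw [twInt, twInt, hw]
    refine ⟨(integrable_twInt_pair J hφ hφc c0 s0 z).congr h3, ?_⟩
    rw [h2]
    exact integral_congr_ae h3
  · filter_upwards [coeFn_VTheta J hmem.toLp,
      (measurePreserving_mapV J).quasiMeasurePreserving.ae hmem.coeFn_toLp] with z h1 h2
    refine ⟨integrable_comulFun_mul_regTensorKernel J hφ hφc hζ hζc z, ?_⟩
    rw [integral_comulFun_mul_regTensorKernel J hφ hφc hζ hζc, h1, h2, ← integral_const_mul]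
    congr 1 with w
    exact Theta_mul_twInt_pullTheta hJ φ ζ z w

theorem isRegTensor_comul {J : Matrix (Fin n) (Fin n) ℝ} (hJ : J.transpose = -J)
    {φ : X n → ℂ} (hφ : Continuous φ) (hφc : HasCompactSupport φ) {T : L2 (X n) →L[ℂ] L2 (X n)}
    (hT : IsReg J φ T) : IsRegTensor J (comulFun J φ) (comul J T) := by
  intro ζ hζ hζc κ hκ
  obtain ⟨η, h1, h2⟩ := exists_isRegAmp_and_isRegTensorAt hJ hφ hφc hζ hζc hκ
  have h3 : comul J T κ = VTheta J η := by
    rw [h1.eq_ampl hT]; rfl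
  rw [h3]
  exact h2

theorem IsRegTensor.unique {J : Matrix (Fin n) (Fin n) ℝ} {F : X n × X n → ℂ}
    {B B' : L2 (X n × X n) →L[ℂ] L2 (X n × X n)} (h : IsRegTensor J F B)
    (h' : IsRegTensor J F B') : B = B' := by
  apply DFunLike.coe_injective
  have hd := Lp.dense_hasCompactSupport_contDiff (E := X n × X n) (F := ℂ) (p := 2)
    (μ := volume) (by simp)
  refine Continuous.ext_on hd B.continuous B'.continuous ?_
  rintro κ ⟨ζ, hκ, hζc, hζ⟩
  apply Lp.ext
  filter_upwards [h ζ hζ hζc κ hκ, h' ζ hζ hζc κ hκ] with z h1 h2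
  rw [h1.2, h2.2]

/-! ### Approximation of symbols by partial Fourier transforms -/

/-- The coordinate on `ℝ`, in the form that `ft` requires. -/
def coordR : ℝ ≃L[ℝ] ℝ := ContinuousLinearEquiv.refl ℝ ℝ

theorem measurePreserving_coordR : MeasurePreserving coordR := MeasurePreserving.id _

theorem enorm_integral_fourierChar_mul_le {E : Type} [MeasureSpace E] (θ : E → ℝ) (F : E → ℂ) :
    ‖∫ s, (Real.fourierChar (θ s) : ℂ) * F s‖ₑ ≤ ∫⁻ s, ‖F s‖ₑ := by
  refine (enorm_integral_le_lintegral_enorm _).trans (le_of_eq ?_)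
  simp only [enorm_mul, enorm_circle, one_mul]

theorem hasCompactSupport_comp_swap {φ : X n → ℂ} (hφc : HasCompactSupport φ) :
    HasCompactSupport fun p : ℝ × (V n × V n) => φ (p.2.1, p.2.2, p.1) := by
  refine HasCompactSupport.intro
    (hφc.isCompact.image (f := fun u : X n => (u.2.2, (u.1, u.2.1))) (by fun_prop)) fun k hk => ?_
  exact image_eq_zero_of_notMem_tsupport (f := φ) fun h => hk ⟨_, h, rfl⟩

theorem hasCompactSupport_comp_assoc {φ : X n → ℂ} (hφc : HasCompactSupport φ) :
    HasCompactSupport fun p : (V n × V n) × ℝ => φ (p.1.1, p.1.2, p.2) := by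
  refine HasCompactSupport.intro
    (hφc.isCompact.image (f := fun u : X n => ((u.1, u.2.1), u.2.2)) (by fun_prop)) fun k hk => ?_
  exact image_eq_zero_of_notMem_tsupport (f := φ) fun h => hk ⟨_, h, rfl⟩

theorem hasCompactSupport_line {φ : X n → ℂ} (hφc : HasCompactSupport φ) (w : V n × V n) :
    HasCompactSupport fun r : ℝ => φ (w.1, w.2, r) := by
  refine HasCompactSupport.intro
    (hφc.isCompact.image (f := fun u : X n => u.2.2) (by fun_prop)) fun k hk => ?_
  exact image_eq_zero_of_notMem_tsupport (f := φ) fun h => hk ⟨_, h, rfl⟩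

/-- The full Fourier transform of `φ`, with the frequency `s` dual to `r` written first. -/
def fullFt (φ : X n → ℂ) : ℝ × (V n × V n) → ℂ :=
  ft (prodCoord coordR (coordW n)) fun p : ℝ × (V n × V n) => φ (p.2.1, p.2.2, p.1)

theorem integrable_fullFt {φ : X n → ℂ} (hs : ContDiff ℝ ∞ φ) (hc : HasCompactSupport φ) :
    Integrable (fullFt φ) := by
  refine integrable_ft (measurePreserving_prodCoord measurePreserving_coordR
    (measurePreserving_coordW n)) ?_ (hasCompactSupport_comp_swap hc)
  fun_prop

/-- The partial transform `φ^∨` is recovered from the full Fourier transform by inversion in the last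
variable. -/
theorem ae_pft_eq_integral_fullFt {φ : X n → ℂ} (hs : ContDiff ℝ ∞ φ)
    (hc : HasCompactSupport φ) :
    ∀ᵐ w : V n × V n, Integrable (fun s => fullFt φ (s, w)) ∧
      ∀ r, pft φ w r = ∫ s, (Real.fourierChar (-inner ℝ (coordR r) (coordR s)) : ℂ) *
        fullFt φ (s, w) := by
  have hcont := hs.continuous
  have h := ae_partial_fourier_inversion (e₁ := coordR) (e₂ := coordW n)
    measurePreserving_coordR (g := fun p : ℝ × (V n × V n) => φ (p.2.1, p.2.2, p.1))
    (by fun_prop) (hasCompactSupport_comp_swap hc) (integrable_fullFt hs hc)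
  filter_upwards [h] with w hw
  refine ⟨hw.1, fun r => ?_⟩
  rw [pft_eq_ft]
  exact hw.2 r

/-- For a test function `φ`, the functions `φ^∨(·, r)` have a common integrable bound. -/
theorem exists_integrable_bound_pft {φ : X n → ℂ} (hs : ContDiff ℝ ∞ φ)
    (hc : HasCompactSupport φ) : ∃ D : V n × V n → ENNReal, AEMeasurable D ∧ ∫⁻ w, D w ≠ ⊤ ∧
      ∀ᵐ w, ∀ r, ‖pft φ w r‖ₑ ≤ D w := by
  have hi : Integrable (fullFt φ) ((volume : Measure ℝ).prod (volume : Measure (V n × V n))) :=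
    integrable_fullFt hs hc
  refine ⟨fun w => ∫⁻ s, ‖fullFt φ (s, w)‖ₑ, ?_, ?_, ?_⟩
  · exact hi.aestronglyMeasurable.enorm.lintegral_prod_left'
  · rw [← lintegral_prod_symm _ hi.aestronglyMeasurable.enorm]
    exact hi.2.ne
  · filter_upwards [ae_pft_eq_integral_fullFt hs hc] with w hw r
    rw [hw.2 r]
    exact enorm_integral_fourierChar_mul_le _ _

theorem exists_lintegral_enorm_pft_le {φ : X n → ℂ} (hs : ContDiff ℝ ∞ φ)
    (hc : HasCompactSupport φ) : ∃ C : ℝ≥0, ∀ r, ∫⁻ w, ‖pft φ w r‖ₑ ≤ C := by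
  obtain ⟨D, -, hD, hle⟩ := exists_integrable_bound_pft hs hc
  refine ⟨(∫⁻ w, D w).toNNReal, fun r => ?_⟩
  rw [ENNReal.coe_toNNReal hD]
  refine lintegral_mono_ae ?_
  filter_upwards [hle] with w hw using hw r

theorem exists_isReg (J : Matrix (Fin n) (Fin n) ℝ) {φ : X n → ℂ} (hs : ContDiff ℝ ∞ φ)
    (hc : HasCompactSupport φ) : ∃ T, IsReg J φ T := by
  obtain ⟨C, hC⟩ := exists_lintegral_enorm_pft_le hs hc
  obtain ⟨T, hT, -⟩ := exists_isTw J (continuous_pft hs.continuous hc).measurable hC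
  exact ⟨T, hT⟩

/-- The symbol of twisted convolution given by a function on the space of triples `(x, y, r)`. -/
def symb (g : X n → ℂ) (w : V n × V n) (r : ℝ) : ℂ := g (w.1, w.2, r)

theorem continuous_symb {g : X n → ℂ} (hg : Continuous g) :
    Continuous fun p : (V n × V n) × ℝ => symb g p.1 p.2 := by
  unfold symb; fun_prop

/-- The partial Fourier transform in the last variable. -/
def lineFt (g : X n → ℂ) (p : ℝ × (V n × V n)) : ℂ := ft coordR (symb g p.2) p.1

theorem integrable_lineFt_line {g : X n → ℂ} (hs : ContDiff ℝ ∞ g) (hc : HasCompactSupport g)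
    (w : V n × V n) : Integrable fun s => lineFt g (s, w) := by
  refine integrable_ft measurePreserving_coordR ?_ (hasCompactSupport_line hc w)
  fun_prop

theorem symb_eq_integral_lineFt {g : X n → ℂ} (hs : ContDiff ℝ ∞ g) (hc : HasCompactSupport g)
    (w : V n × V n) (r : ℝ) :
    symb g w r = ∫ s, (Real.fourierChar (-inner ℝ (coordR r) (coordR s)) : ℂ) *
      lineFt g (s, w) := by
  have hcont : Continuous (symb g w) := by
    have := hs.continuous
    unfold symb; fun_prop
  exact (integral_fourierChar_neg_mul_ft measurePreserving_coordR hcont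
    (hcont.integrable_of_hasCompactSupport (hasCompactSupport_line hc w))
    (integrable_lineFt_line hs hc w) r).symm

theorem continuous_lineFt {g : X n → ℂ} (hg : Continuous g) (hc : HasCompactSupport g) :
    Continuous (lineFt g) := by
  unfold lineFt ft symb
  have c1 := Real.continuous_fourierChar
  refine continuous_integral_of_forall_notMem_eq_zero ?_
    (hc.isCompact.image (f := fun u : X n => u.2.2) (by fun_prop)) fun p r hr => ?_
  · simp only [Function.uncurry_def]
    fun_prop
  · exact mul_eq_zero_of_right _
      (image_eq_zero_of_notMem_tsupport (f := g) fun h => hr ⟨_, h, rfl⟩)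

/-- The transform in the last variable of a test function is integrable: it has compact support in
the variables `(x, y)`, and for fixed `s` it is bounded by the `L¹` norm of the full Fourier transform
at the frequency `s`. -/
theorem integrable_lineFt {g : X n → ℂ} (hs : ContDiff ℝ ∞ g) (hc : HasCompactSupport g) :
    Integrable (lineFt g) ((volume : Measure ℝ).prod (volume : Measure (V n × V n))) := by
  have hcont := hs.continuous
  let g' : (V n × V n) × ℝ → ℂ := fun p => g (p.1.1, p.1.2, p.2)
  have hi : Integrable (ft (prodCoord (coordW n) coordR) g')
      ((volume : Measure (V n × V n)).prod (volume : Measure ℝ)) :=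
    integrable_ft (measurePreserving_prodCoord (measurePreserving_coordW n)
      measurePreserving_coordR) (by fun_prop) (hasCompactSupport_comp_assoc hc)
  have hinv := ae_partial_fourier_inversion (e₁ := coordW n) (e₂ := coordR)
    (measurePreserving_coordW n) (g := g') (by fun_prop) (hasCompactSupport_comp_assoc hc) hi
  set A := (fun u : X n => (u.1, u.2.1)) '' tsupport g with hA
  have cA : IsCompact A := hc.isCompact.image (by fun_prop)
  have h0 : ∀ s, ∀ w ∉ A, lineFt g (s, w) = 0 := by
    intro s w hw
    have : ∀ r, symb g w r = 0 := fun r =>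
      image_eq_zero_of_notMem_tsupport (f := g) fun h => hw ⟨_, h, rfl⟩
    simp [lineFt, ft, this]
  refine ⟨(continuous_lineFt hcont hc).aestronglyMeasurable, ?_⟩
  rw [hasFiniteIntegral_iff_enorm,
    lintegral_prod _ (continuous_lineFt hcont hc).measurable.enorm.aemeasurable]
  have hle : ∀ᵐ s : ℝ, ∫⁻ w, ‖lineFt g (s, w)‖ₑ ≤
      (∫⁻ k, ‖ft (prodCoord (coordW n) coordR) g' (k, s)‖ₑ) * volume A := by
    filter_upwards [hinv] with s hsv
    rw [← setLIntegral_const, ← lintegral_indicator cA.measurableSet]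
    refine lintegral_mono fun w => ?_
    by_cases hw : w ∈ A
    · rw [Set.indicator_of_mem hw]
      have : lineFt g (s, w) = _ := hsv.2 w
      rw [this]
      exact enorm_integral_fourierChar_mul_le _ _
    · simp [h0 s w hw]
  refine (lintegral_mono_ae hle).trans_lt ?_
  rw [lintegral_mul_const' _ _ cA.measure_lt_top.ne,
    ← lintegral_prod_symm _ hi.aestronglyMeasurable.enorm]
  exact ENNReal.mul_lt_top hi.2 cA.measure_lt_top

/-- A test function, as a symbol, is approximated by the partial transforms `φ^∨` of test functions,
in `L¹` and uniformly in `r`. On the side of the full Fourier transform in the last variable this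
reduces to the density of the Fourier transforms of test functions in `L¹`. -/
theorem exists_lintegral_symb_sub_pft_le {g : X n → ℂ} (hs : ContDiff ℝ ∞ g)
    (hc : HasCompactSupport g) {ε : ℝ} (hε : 0 < ε) :
    ∃ φ : X n → ℂ, ContDiff ℝ ∞ φ ∧ HasCompactSupport φ ∧
      ∀ r, ∫⁻ w, ‖symb g w r - pft φ w r‖ₑ ≤ ENNReal.ofReal ε := by
  obtain ⟨φ', hc', hs', hle⟩ := exists_lintegral_sub_ft_le
    (measurePreserving_prodCoord measurePreserving_coordR (measurePreserving_coordW n))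
    (integrable_lineFt hs hc) hε
  have hφs : ContDiff ℝ ∞ fun u : X n => φ' (u.2.2, (u.1, u.2.1)) := by fun_prop
  have hφc : HasCompactSupport fun u : X n => φ' (u.2.2, (u.1, u.2.1)) := by
    refine HasCompactSupport.intro (hc'.isCompact.image
      (f := fun p : ℝ × (V n × V n) => ((p.2.1, p.2.2, p.1) : X n)) (by fun_prop)) fun k hk => ?_
    exact image_eq_zero_of_notMem_tsupport (f := φ') fun h => hk ⟨_, h, rfl⟩
  refine ⟨_, hφs, hφc, fun r => ?_⟩
  set φ : X n → ℂ := fun u => φ' (u.2.2, (u.1, u.2.1))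
  have hle' : ∫⁻ x, ‖lineFt g x - fullFt φ x‖ₑ ∂((volume : Measure ℝ).prod
      (volume : Measure (V n × V n))) ≤ ENNReal.ofReal ε := hle
  have hi : Integrable (fullFt φ) ((volume : Measure ℝ).prod (volume : Measure (V n × V n))) :=
    integrable_fullFt hφs hφc
  have hm : AEMeasurable (fun x => ‖lineFt g x - fullFt φ x‖ₑ)
      ((volume : Measure ℝ).prod (volume : Measure (V n × V n))) :=
    ((integrable_lineFt hs hc).aestronglyMeasurable.sub hi.aestronglyMeasurable).enorm
  rw [lintegral_prod_symm _ hm] at hle'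
  refine le_trans (lintegral_mono_ae ?_) hle'
  filter_upwards [ae_pft_eq_integral_fullFt hφs hφc] with w hw
  have hb : ∀ F : ℝ → ℂ, Integrable F → Integrable fun s =>
      (Real.fourierChar (-inner ℝ (coordR r) (coordR s)) : ℂ) * F s := by
    intro F hF
    have c1 := Real.continuous_fourierChar
    exact hF.bdd_mul (c := 1) (Continuous.aestronglyMeasurable (by fun_prop))
      (Filter.Eventually.of_forall fun s => (Circle.norm_coe _).le)
  rw [symb_eq_integral_lineFt hs hc, hw.2 r, ← integral_sub (hb _ (integrable_lineFt_line hs hc w))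
    (hb _ hw.1)]
  simp only [← mul_sub]
  exact enorm_integral_fourierChar_mul_le _ _

/-! ### The closure of the operators `L_φ` -/

theorem pft_add {φ ψ : X n → ℂ} (hφ : Continuous φ) (hφc : HasCompactSupport φ)
    (hψ : Continuous ψ) (hψc : HasCompactSupport ψ) : pft (φ + ψ) = pft φ + pft ψ := by
  have key : ∀ {χ : X n → ℂ}, Continuous χ → HasCompactSupport χ → ∀ w r,
      Integrable fun k : V n × V n => χ (k.1, k.2, r) * (pairing k w : ℂ) := by
    intro χ h1 h2 w r
    have := continuous_pairing (n := n)
    refine Continuous.integrable_of_hasCompactSupport (Continuous.mul (by fun_prop)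
      (this.comp (Continuous.prodMk_left w))) (hasCompactSupport_fibre h2 r).mul_right
  funext w r
  simp only [pft, Pi.add_apply, add_mul]
  exact integral_add (key hφ hφc w r) (key hψ hψc w r)

/-- The operators `L_φ`, for test functions `φ`, as a linear subspace. -/
def regSubmodule (J : Matrix (Fin n) (Fin n) ℝ) : Submodule ℂ (L2 (X n) →L[ℂ] L2 (X n)) where
  carrier := {T | ∃ φ : X n → ℂ, ContDiff ℝ ∞ φ ∧ HasCompactSupport φ ∧ IsReg J φ T}
  zero_mem' := by
    refine ⟨0, contDiff_const, HasCompactSupport.zero, fun ζ => ?_⟩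
    have e : ∀ u, regIntegrand J 0 ζ u = 0 := fun u => by
      funext w
      simp [regIntegrand, pft]
    filter_upwards [Lp.coeFn_zero ℂ 2 (volume : Measure (X n))] with u hu
    rw [e]
    exact ⟨integrable_zero _ _ _, by simpa using hu⟩
  add_mem' := by
    rintro T T' ⟨φ, hs, hc, h⟩ ⟨φ', hs', hc', h'⟩
    refine ⟨φ + φ', hs.add hs', hc.add hc', ?_⟩
    rw [isReg_iff_isTw, pft_add hs.continuous hc hs'.continuous hc']
    exact IsTw.add h h'
  smul_mem' := by
    rintro c T ⟨φ, hs, hc, h⟩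
    refine ⟨c • φ, hs.const_smul c, hc.smul_left (f := fun _ => c), ?_⟩
    have e : pft (c • φ) = c • pft φ := by
      funext w r
      simp only [pft, Pi.smul_apply, smul_eq_mul, mul_assoc]
      exact integral_const_mul c _
    rw [isReg_iff_isTw, e]
    exact IsTw.smul c h

/-- Approximation of symbols in `L¹`, uniformly in `r`, is approximation of operators in norm. -/
theorem IsTw.mem_of_forall_exists {J : Matrix (Fin n) (Fin n) ℝ} {f : V n × V n → ℝ → ℂ}
    {T : L2 (X n) →L[ℂ] L2 (X n)} (h : IsTw J f T)
    (hf : Measurable fun p : (V n × V n) × ℝ => f p.1 p.2)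
    {S : Set (L2 (X n) →L[ℂ] L2 (X n))} (hS : IsClosed S)
    (happ : ∀ ε : ℝ, 0 < ε → ∃ f' T', IsTw J f' T' ∧
      (Measurable fun p : (V n × V n) × ℝ => f' p.1 p.2) ∧ T' ∈ S ∧
      ∀ r, ∫⁻ w, ‖f w r - f' w r‖ₑ ≤ ENNReal.ofReal ε) : T ∈ S := by
  rw [← hS.closure_eq, Metric.mem_closure_iff]
  intro ε hε
  obtain ⟨f', T', hT', hf', hmem, hle⟩ := happ (ε / 2) (half_pos hε)
  refine ⟨T', hmem, ?_⟩
  rw [dist_eq_norm]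
  refine (h.norm_sub_le hT' hf hf' hle).trans_lt ?_
  rw [Real.coe_toNNReal _ (half_pos hε).le]
  exact half_lt_self hε

theorem lintegral_enorm_symb_le {g : X n → ℂ} {C : ℝ} (hC : ∀ u, ‖g u‖ ≤ C)
    {A : Set (V n × V n)} (hA : IsCompact A) (h0 : ∀ w ∉ A, ∀ r, symb g w r = 0) (r : ℝ) :
    ∫⁻ w, ‖symb g w r‖ₑ ≤ ENNReal.ofReal (C * (volume A).toReal) := by
  have hC0 : 0 ≤ C := (norm_nonneg _).trans (hC 0)
  rw [ENNReal.ofReal_mul hC0, ENNReal.ofReal_toReal hA.measure_lt_top.ne,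
    ← setLIntegral_const, ← lintegral_indicator hA.measurableSet]
  refine lintegral_mono fun w => ?_
  by_cases hw : w ∈ A
  · rw [Set.indicator_of_mem hw, ← ofReal_norm]
    exact ENNReal.ofReal_le_ofReal (hC _)
  · simp [h0 w hw]

theorem isCompact_image_tsupport {g : X n → ℂ} (hc : HasCompactSupport g) :
    IsCompact ((fun u : X n => (u.1, u.2.1)) '' tsupport g) := hc.isCompact.image (by fun_prop)

theorem symb_eq_zero_of_notMem {g : X n → ℂ} {w : V n × V n}
    (hw : w ∉ (fun u : X n => (u.1, u.2.1)) '' tsupport g) (r : ℝ) : symb g w r = 0 :=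
  image_eq_zero_of_notMem_tsupport (f := g) fun h => hw ⟨_, h, rfl⟩

theorem exists_isTw_symb (J : Matrix (Fin n) (Fin n) ℝ) {g : X n → ℂ} (hg : Continuous g)
    (hc : HasCompactSupport g) : ∃ T, IsTw J (symb g) T := by
  obtain ⟨C, hC⟩ := hg.bounded_above_of_compact_support hc
  obtain ⟨T, hT, -⟩ := exists_isTw J (continuous_symb hg).measurable
    (lintegral_enorm_symb_le hC (isCompact_image_tsupport hc)
      fun w hw r => symb_eq_zero_of_notMem hw r)
  exact ⟨T, hT⟩

theorem IsTw.mem_closure_of_contDiff {J : Matrix (Fin n) (Fin n) ℝ} {g : X n → ℂ}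
    (hs : ContDiff ℝ ∞ g) (hc : HasCompactSupport g) {T : L2 (X n) →L[ℂ] L2 (X n)}
    (h : IsTw J (symb g) T) : T ∈ closure (regSubmodule J : Set (L2 (X n) →L[ℂ] L2 (X n))) := by
  refine h.mem_of_forall_exists (continuous_symb hs.continuous).measurable isClosed_closure
    fun ε hε => ?_
  obtain ⟨φ, hφs, hφc, hle⟩ := exists_lintegral_symb_sub_pft_le hs hc hε
  obtain ⟨T', hT'⟩ := exists_isReg J hφs hφc
  exact ⟨pft φ, T', hT', (continuous_pft hφs.continuous hφc).measurable,
    subset_closure ⟨φ, hφs, hφc, hT'⟩, hle⟩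

theorem exists_pos_mul_le {M : ℝ} (hM : 0 ≤ M) {ε : ℝ} (hε : 0 < ε) :
    ∃ δ : ℝ, 0 < δ ∧ δ * M ≤ ε := by
  refine ⟨ε / (M + 1), by positivity, ?_⟩
  rw [div_mul_eq_mul_div, div_le_iff₀ (by positivity)]
  nlinarith

theorem IsTw.mem_closure_of_continuous {J : Matrix (Fin n) (Fin n) ℝ} {g : X n → ℂ}
    (hg : Continuous g) (hc : HasCompactSupport g) {T : L2 (X n) →L[ℂ] L2 (X n)}
    (h : IsTw J (symb g) T) : T ∈ closure (regSubmodule J : Set (L2 (X n) →L[ℂ] L2 (X n))) := by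
  refine h.mem_of_forall_exists (continuous_symb hg).measurable isClosed_closure
    fun ε hε => ?_
  set A := (fun u : X n => (u.1, u.2.1)) '' tsupport g
  obtain ⟨δ, hδ, hδε⟩ := exists_pos_mul_le (M := (volume A).toReal) ENNReal.toReal_nonneg hε
  obtain ⟨g', hs', happ, hsupp⟩ := hg.exists_contDiff_approx ⊤ (ε := fun _ => δ) continuous_const
    fun _ => hδ
  have hc' : HasCompactSupport g' := hc.mono hsupp
  obtain ⟨T', hT'⟩ := exists_isTw_symb J hs'.continuous hc'
  refine ⟨symb g', T', hT', (continuous_symb hs'.continuous).measurable,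
    hT'.mem_closure_of_contDiff hs' hc', fun r => ?_⟩
  refine (lintegral_enorm_symb_le (g := fun u => g u - g' u) (C := δ) (fun u => ?_)
    (isCompact_image_tsupport hc) (fun w hw r => ?_) r).trans (ENNReal.ofReal_le_ofReal hδε)
  · rw [← dist_eq_norm, dist_comm]
    exact (happ u).le
  · have h1 := symb_eq_zero_of_notMem hw r
    have h2 : g' (w.1, w.2, r) = 0 := by
      by_contra hne
      exact hsupp hne h1
    rw [symb] at h1 ⊢
    simp [h1, h2]

/-! ### Slices of the multiplicative unitary and the algebra `S` -/

/-- The symbol of the slice `(ω_{ξ,η} ⊗ id)(V_Θ)`. -/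
def sliceFun (J : Matrix (Fin n) (Fin n) ℝ) (ξ η : X n → ℂ) (u : X n) : ℂ :=
  ∫ r, starRingEnd ℂ (η (u.1 + u.2.2 • J.mulVec u.2.1, u.2.1, r)) * ξ (u.1, u.2.1, r + u.2.2)

theorem continuous_sliceFun (J : Matrix (Fin n) (Fin n) ℝ) {ξ η : X n → ℂ} (hξ : Continuous ξ)
    (hη : Continuous η) (hηc : HasCompactSupport η) : Continuous (sliceFun J ξ η) := by
  unfold sliceFun
  refine continuous_integral_of_forall_notMem_eq_zero ?_
    (hηc.isCompact.image (f := fun u : X n => u.2.2) (by fun_prop)) fun u r hr => ?_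
  · simp only [Function.uncurry_def]
    refine Continuous.mul (Complex.continuous_conj.comp (hη.comp ?_)) (by fun_prop)
    have : Continuous fun p : X n × ℝ => J.mulVec p.1.2.1 := by fun_prop
    fun_prop
  · rw [image_eq_zero_of_notMem_tsupport (f := η) fun h => hr ⟨_, h, rfl⟩]
    simp

theorem hasCompactSupport_sliceFun (J : Matrix (Fin n) (Fin n) ℝ) {ξ η : X n → ℂ}
    (hξc : HasCompactSupport ξ) (hηc : HasCompactSupport η) :
    HasCompactSupport (sliceFun J ξ η) := by
  refine HasCompactSupport.intro ((hξc.isCompact.prod hηc.isCompact).image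
    (f := fun p : X n × X n => ((p.1.1, p.1.2.1, p.1.2.2 - p.2.2.2) : X n)) (by fun_prop))
    fun u hu => ?_
  unfold sliceFun
  refine integral_eq_zero_of_ae (Filter.Eventually.of_forall fun r => ?_)
  by_cases h1 : ((u.1, u.2.1, r + u.2.2) : X n) ∈ tsupport ξ
  · by_cases h2 : ((u.1 + u.2.2 • J.mulVec u.2.1, u.2.1, r) : X n) ∈ tsupport η
    · exact absurd ⟨(_, _), ⟨h1, h2⟩, by simp⟩ hu
    · simp [image_eq_zero_of_notMem_tsupport h2]
  · simp [image_eq_zero_of_notMem_tsupport h1]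

theorem Theta_eq_sigma (J : Matrix (Fin n) (Fin n) ℝ) (w : V n × V n) (r : ℝ) (u' : X n) :
    Theta J ((w.1, w.2, r), tr u' w) = sigma J u'.2.2 w (u'.1 - w.1, u'.2.1 - w.2) := by
  simp only [Theta, sigma, tr]
  exact mul_comm _ _

/-- The slice of `V_Θ` at the functional `ω_{ξ,η}` is a twisted convolution operator. -/
theorem isTw_slice (J : Matrix (Fin n) (Fin n) ℝ) {ξ₀ η₀ : X n → ℂ} (hξ : Continuous ξ₀)
    (hξc : HasCompactSupport ξ₀) (hη : Continuous η₀) (hηc : HasCompactSupport η₀)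
    {ξ η : L2 (X n)} (eξ : ξ =ᵐ[volume] ξ₀) (eη : η =ᵐ[volume] η₀) :
    IsTw J (symb (sliceFun J ξ₀ η₀))
      (slice ξ η ((VTheta J).toContinuousLinearEquiv : _ →L[ℂ] _)) := by
  obtain ⟨T, hT⟩ := exists_isTw_symb J (continuous_sliceFun J hξ hη hηc)
    (hasCompactSupport_sliceFun J hξc hηc)
  suffices h : slice ξ η ((VTheta J).toContinuousLinearEquiv : _ →L[ℂ] _) = T by rw [h]; exact hT
  ext1 ζ
  refine ext_inner_left ℂ fun χ => ?_
  have e1 : inner ℂ χ (slice ξ η ((VTheta J).toContinuousLinearEquiv : _ →L[ℂ] _) ζ) =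
      inner ℂ (tmul η χ) (VTheta J (tmul ξ ζ)) :=
    ContinuousLinearMap.adjoint_inner_right (tmulLeft η) χ _
  rw [e1, inner_tmul_eq_integral, L2.inner_def]
  have hκ : VTheta J (tmul ξ ζ) =ᵐ[volume] fun z : X n × X n =>
      (Theta J (mapV J z) : ℂ) * (ξ₀ (mapV J z).1 * ζ (mapV J z).2) := by
    filter_upwards [coeFn_VTheta J (tmul ξ ζ),
      (measurePreserving_mapV J).quasiMeasurePreserving.ae (coeFn_tmul ξ ζ),
      (measurePreserving_mapV J).quasiMeasurePreserving.ae (ae_fst eξ)] with z h1 h2 h3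
    rw [h1, h2, h3]
  have hκ' := Measure.ae_ae_of_ae_prod
    ((Measure.measurePreserving_swap (μ := (volume : Measure (X n)))
      (ν := (volume : Measure (X n)))).quasiMeasurePreserving.ae hκ)
  refine integral_congr_ae ?_
  filter_upwards [hκ', hT ζ, ae_memLp_slice (VTheta J (tmul ξ ζ))] with u' h1 h2 h3
  rw [RCLike.inner_apply, mul_comm]
  congr 1
  rw [h2.2]
  set h : X n → ℂ := fun u => starRingEnd ℂ (η₀ u) *
    ((Theta J (mapV J (u, u')) : ℂ) * (ξ₀ (mapV J (u, u')).1 * ζ (mapV J (u, u')).2)) with hh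
  have eh : (fun u => starRingEnd ℂ (η u) * VTheta J (tmul ξ ζ) (u, u')) =ᵐ[volume] h := by
    filter_upwards [eη, h1] with u a1 a2
    rw [hh, a1]
    exact congrArg _ a2
  have hi : Integrable h := by
    refine Integrable.congr ?_ eh
    exact (Lp.memLp η).star.integrable_mul h3
  rw [integral_congr_ae eh]
  -- the substitution `x ↦ x + r' J y` followed by separation of the variable `r`
  let s : X n ≃ᵐ X n := shearL (fun v : V n × ℝ => u'.2.2 • J.mulVec v.1) (by fun_prop)
  have hs : MeasurePreserving s := shearL_mp _ _
  let a : (V n × V n) × ℝ ≃ᵐ X n := MeasurableEquiv.prodAssoc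
  have ha : MeasurePreserving a := volume_preserving_prodAssoc
  have hsa := hs.comp ha
  have me : MeasurableEmbedding (s ∘ a) := s.measurableEmbedding.comp a.measurableEmbedding
  have hi' : Integrable (h ∘ (s ∘ a))
      ((volume : Measure (V n × V n)).prod (volume : Measure ℝ)) :=
    (hsa.integrable_comp_emb me).2 hi
  have e2 : ∫ u, h u = ∫ p : (V n × V n) × ℝ, (h ∘ (s ∘ a)) p := (hsa.integral_comp me h).symm
  rw [e2]
  refine (integral_prod _ hi').trans ?_
  refine integral_congr_ae (Filter.Eventually.of_forall fun w => ?_)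
  have e3 : ∀ r : ℝ, (h ∘ (s ∘ a)) (w, r) =
      (starRingEnd ℂ (η₀ (w.1 + u'.2.2 • J.mulVec w.2, w.2, r)) * ξ₀ (w.1, w.2, r + u'.2.2)) *
        ((sigma J u'.2.2 w (u'.1 - w.1, u'.2.1 - w.2) : ℂ) * ζ (tr u' w)) := by
    intro r
    have e4 : (s ∘ a) (w, r) = (w.1 + u'.2.2 • J.mulVec w.2, w.2, r) := rfl
    have e5 : mapV J ((w.1 + u'.2.2 • J.mulVec w.2, w.2, r), u') =
        ((w.1, w.2, r + u'.2.2), tr u' w) := by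
      rw [mapV_apply]
      simp only [tr]
      ext <;> simp
      ring
    rw [Function.comp_apply, e4, hh]
    simp only [e5, Theta_eq_sigma]
    ring
  simp only [e3]
  rw [integral_mul_const, twInt, mul_assoc]
  rfl

section Slice
variable {α : Type} [MeasureSpace α] [SigmaFinite (volume : Measure α)]

theorem continuous_tmulLeft : Continuous (tmulLeft : L2 α → L2 α →L[ℂ] L2 (α × α)) := by
  refine LipschitzWith.continuous (K := 1) (LipschitzWith.of_dist_le_mul fun f g => ?_)
  rw [dist_eq_norm, dist_eq_norm, NNReal.coe_one, one_mul]
  refine ContinuousLinearMap.opNorm_le_bound _ (norm_nonneg _) fun h => ?_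
  have e : (tmulLeft f - tmulLeft g) h = tmul (f - g) h := by
    have := congrArg (fun A : L2 α →ₗ[ℂ] L2 (α × α) => A h) ((tmulₗ α).map_sub f g)
    exact this.symm
  rw [e, norm_tmul]

theorem continuous_slice (W : L2 (α × α) →L[ℂ] L2 (α × α)) :
    Continuous fun p : L2 α × L2 α => slice p.1 p.2 W := by
  unfold slice
  refine Continuous.clm_comp ?_ (continuous_const.clm_comp
    (continuous_tmulLeft.comp continuous_fst))
  exact ContinuousLinearMap.adjoint.continuous.comp (continuous_tmulLeft.comp continuous_snd)

end Slice

/-- By continuity in `ξ` and `η`, these may be taken to be test functions; then the symbol of the slice is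
continuous of compact support. -/
theorem slice_mem_closure (J : Matrix (Fin n) (Fin n) ℝ) (ξ η : L2 (X n)) :
    slice ξ η ((VTheta J).toContinuousLinearEquiv : _ →L[ℂ] _) ∈
      closure (regSubmodule J : Set (L2 (X n) →L[ℂ] L2 (X n))) := by
  have hd := Lp.dense_hasCompactSupport_contDiff (E := X n) (F := ℂ) (p := 2)
    (μ := volume) (by simp)
  have hc := continuous_slice
    ((VTheta J).toContinuousLinearEquiv : L2 (X n × X n) →L[ℂ] L2 (X n × X n))
  refine hd.induction (P := fun ξ => slice ξ η _ ∈ _) (fun f ⟨f₀, e1, c1, s1⟩ => ?_)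
    (isClosed_closure.preimage (hc.comp (Continuous.prodMk_left η))) ξ
  refine hd.induction (P := fun η => slice f η _ ∈ _) (fun g ⟨g₀, e2, c2, s2⟩ => ?_)
    (isClosed_closure.preimage (hc.comp (Continuous.prodMk_right f))) η
  exact (isTw_slice J s1.continuous c1 s2.continuous c2 e1 e2).mem_closure_of_continuous
    (continuous_sliceFun J s1.continuous s2.continuous c2) (hasCompactSupport_sliceFun J c1 c2)

theorem algS_le_closure (J : Matrix (Fin n) (Fin n) ℝ) :
    (algS J : Set (L2 (X n) →L[ℂ] L2 (X n))) ⊆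
      closure (regSubmodule J : Set (L2 (X n) →L[ℂ] L2 (X n))) := by
  have h : algS J ≤ (regSubmodule J).topologicalClosure := by
    refine Submodule.topologicalClosure_minimal _ ?_ (Submodule.isClosed_topologicalClosure _)
    rw [Submodule.span_le]
    rintro _ ⟨ξ, η, rfl⟩
    exact slice_mem_closure J ξ η
  exact h

theorem slice_mem_algS (J : Matrix (Fin n) (Fin n) ℝ) (ξ η : L2 (X n)) :
    slice ξ η ((VTheta J).toContinuousLinearEquiv : _ →L[ℂ] _) ∈ algS J :=
  Submodule.le_topologicalClosure _ (Submodule.subset_span ⟨ξ, η, rfl⟩)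

theorem isClosed_algS (J : Matrix (Fin n) (Fin n) ℝ) :
    IsClosed (algS J : Set (L2 (X n) →L[ℂ] L2 (X n))) := Submodule.isClosed_topologicalClosure _

/-- A continuous symbol of compact support gives an operator in `S`: it is the limit of the symbols of
slices at `ω_{ξ,η}` with `ξ` equal to the symbol and `η` the product of a cutoff function and an
approximate identity in the variable `r`. -/
theorem IsTw.mem_algS {J : Matrix (Fin n) (Fin n) ℝ} {ξ₀ : X n → ℂ}
    (hξ : Continuous ξ₀) (hξc : HasCompactSupport ξ₀) {T : L2 (X n) →L[ℂ] L2 (X n)}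
    (h : IsTw J (symb ξ₀) T) : T ∈ algS J := by
  refine h.mem_of_forall_exists (continuous_symb hξ).measurable (isClosed_algS J)
    fun ε hε => ?_
  set A := (fun u : X n => (u.1, u.2.1)) '' tsupport ξ₀
  have cA : IsCompact A := isCompact_image_tsupport hξc
  obtain ⟨ε', hε', hle⟩ := exists_pos_mul_le (M := (volume A).toReal) ENNReal.toReal_nonneg hε
  obtain ⟨δ, hδ, hunif⟩ := Metric.uniformContinuous_iff.1
    (hξc.uniformContinuous_of_continuous hξ) ε' hε'
  obtain ⟨R, hR⟩ := (hξc.isCompact.image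
    (f := fun u : X n => u.2.2) (by fun_prop)).isBounded.exists_norm_le
  -- the cutoff has to be `1` at `(x + r J y, y)` for `(x, y)` in `A` and all `r` that occur; these satisfy
  -- `|r| ≤ R + 1` because the approximate identity is supported in `[-1, 1]`
  have hK : IsCompact ((fun p : (V n × V n) × ℝ => (p.1.1 + p.2 • J.mulVec p.1.2, p.1.2)) ''
      (A ×ˢ Set.Icc (-(R + 1)) (R + 1))) := by
    refine (cA.prod isCompact_Icc).image ?_
    have : Continuous fun p : (V n × V n) × ℝ => J.mulVec p.1.2 := by fun_prop
    fun_prop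
  obtain ⟨χ, hχ1, -, hχc, -⟩ := exists_continuous_one_zero_of_isCompact hK isClosed_empty
    (Set.disjoint_empty _)
  let b : ContDiffBump (0 : ℝ) :=
    ⟨min δ 1 / 2, min δ 1, half_pos (by positivity), half_lt_self (by positivity)⟩
  let ρ : ℝ → ℝ := b.normed volume
  have hρc : Continuous ρ := b.continuous_normed
  have hρ0 : ∀ r, 0 ≤ ρ r := fun r => b.nonneg_normed r
  have hρi : Integrable ρ := b.integrable_normed
  have hρs : ∀ r, ρ r ≠ 0 → |r| < min δ 1 := by
    intro r hr
    have : r ∈ Function.support (b.normed volume) := hr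
    rw [b.support_normed_eq, Metric.mem_ball, dist_zero_right, Real.norm_eq_abs] at this
    exact this
  let η₀ : X n → ℂ := fun u => (χ (u.1, u.2.1) : ℂ) * (ρ u.2.2 : ℂ)
  have hη : Continuous η₀ := by
    have := χ.continuous
    fun_prop
  have hηc : HasCompactSupport η₀ := by
    refine HasCompactSupport.intro ((hχc.isCompact.prod
      (b.hasCompactSupport_normed (μ := volume)).isCompact).image
      (f := fun p : (V n × V n) × ℝ => ((p.1.1, p.1.2, p.2) : X n)) (by fun_prop)) fun u hu => ?_
    by_cases h1 : ((u.1, u.2.1) : V n × V n) ∈ tsupport χ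
    · by_cases h2 : u.2.2 ∈ tsupport (b.normed volume)
      · exact absurd ⟨(_, _), ⟨h1, h2⟩, rfl⟩ hu
      · have : ρ u.2.2 = 0 := image_eq_zero_of_notMem_tsupport h2
        simp [η₀, this]
    · simp [η₀, image_eq_zero_of_notMem_tsupport h1]
  have mξ : MemLp ξ₀ 2 volume := hξ.memLp_of_hasCompactSupport hξc
  have mη : MemLp η₀ 2 volume := hη.memLp_of_hasCompactSupport hηc
  refine ⟨_, _, isTw_slice J hξ hξc hη hηc mξ.coeFn_toLp mη.coeFn_toLp,
    (continuous_symb (continuous_sliceFun J hξ hη hηc)).measurable, slice_mem_algS J _ _,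
    fun r' => ?_⟩
  have hslice : ∀ u : X n, sliceFun J ξ₀ η₀ u = ∫ r, (ρ r : ℂ) * ξ₀ (u.1, u.2.1, r + u.2.2) := by
    intro u
    unfold sliceFun
    congr 1 with r
    by_cases h1 : ρ r = 0
    · simp [η₀, h1]
    by_cases h2 : ((u.1, u.2.1, r + u.2.2) : X n) ∈ tsupport ξ₀
    · have h3 : |r + u.2.2| ≤ R := hR _ ⟨_, h2, rfl⟩
      have h4 : |r| < 1 := (hρs r h1).trans_le (min_le_right _ _)
      have h5 : χ (u.1 + u.2.2 • J.mulVec u.2.1, u.2.1) = 1 := by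
        refine hχ1 ⟨((u.1, u.2.1), u.2.2), ⟨⟨_, h2, rfl⟩, ?_⟩, rfl⟩
        rw [abs_le] at h3
        rw [abs_lt] at h4
        constructor <;> simp only <;> linarith [h3.1, h3.2, h4.1, h4.2]
      simp [η₀, h5]
    · simp [image_eq_zero_of_notMem_tsupport h2]
  have hsub : ∀ u : X n, ξ₀ u - sliceFun J ξ₀ η₀ u =
      ∫ r, (ρ r : ℂ) * (ξ₀ u - ξ₀ (u.1, u.2.1, r + u.2.2)) := by
    intro u
    have i1 : Integrable fun r => (ρ r : ℂ) * ξ₀ u := hρi.ofReal.mul_const _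
    have i2 : Integrable fun r => (ρ r : ℂ) * ξ₀ (u.1, u.2.1, r + u.2.2) := by
      refine Continuous.integrable_of_hasCompactSupport (by fun_prop) ?_
      exact HasCompactSupport.mul_right
        ((b.hasCompactSupport_normed (μ := volume)).comp_left Complex.ofReal_zero)
    simp only [mul_sub]
    rw [integral_sub i1 i2, hslice, integral_mul_const, integral_complex_ofReal]
    have : ∫ r, ρ r = 1 := b.integral_normed
    rw [this]
    simp
  refine (lintegral_enorm_symb_le (g := fun u => ξ₀ u - sliceFun J ξ₀ η₀ u) (C := ε')
    (fun u => ?_) cA (fun w hw r => ?_) r').trans (ENNReal.ofReal_le_ofReal hle)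
  · rw [hsub]
    calc _ ≤ ∫ r, ρ r * ε' := by
          refine norm_integral_le_of_norm_le (hρi.mul_const _)
            (Filter.Eventually.of_forall fun r => ?_)
          rw [norm_mul, Complex.norm_real, Real.norm_of_nonneg (hρ0 r)]
          by_cases h1 : ρ r = 0
          · simp [h1]
          · refine mul_le_mul_of_nonneg_left ?_ (hρ0 r)
            rw [← dist_eq_norm]
            refine (hunif ?_).le
            have : |r| < δ := (hρs r h1).trans_le (min_le_left _ _)
            simpa [Prod.dist_eq, Real.dist_eq, hδ] using this
      _ = ε' := by
          rw [integral_mul_const]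
          have : ∫ r, ρ r = 1 := b.integral_normed
          rw [this, one_mul]
  · have h0 : ∀ r, ξ₀ (w.1, w.2, r) = 0 := fun r => symb_eq_zero_of_notMem hw r
    simp only [symb, hslice, h0]
    simp

theorem exists_setLIntegral_compl_closedBall_le {E : Type} [NormedAddCommGroup E]
    [MeasureSpace E] [BorelSpace E] {D : E → ENNReal} (hD : AEMeasurable D) (hfin : ∫⁻ w, D w ≠ ⊤)
    {ε : ENNReal} (hε : ε ≠ 0) : ∃ N : ℕ, ∫⁻ w in (Metric.closedBall (0 : E) N)ᶜ, D w ≤ ε := by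
  have hlim : Filter.Tendsto (fun N : ℕ => ∫⁻ w, (Metric.closedBall (0 : E) N)ᶜ.indicator D w)
      Filter.atTop (nhds (∫⁻ _ : E, 0)) := by
    refine tendsto_lintegral_of_dominated_convergence' D
      (fun N => hD.indicator Metric.isClosed_closedBall.measurableSet.compl)
      (fun N => Filter.Eventually.of_forall fun w => Set.indicator_le_self _ _ w) hfin
      (Filter.Eventually.of_forall fun w => ?_)
    refine tendsto_const_nhds.congr' ?_
    obtain ⟨N₀, hN₀⟩ := exists_nat_ge ‖w‖
    filter_upwards [Filter.eventually_ge_atTop N₀] with N hN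
    have : w ∈ Metric.closedBall (0 : E) N := by
      rw [mem_closedBall_zero_iff]
      exact hN₀.trans (by exact_mod_cast hN)
    simp [this]
  rw [lintegral_zero] at hlim
  obtain ⟨N, hN⟩ := (hlim.eventually (ge_mem_nhds (pos_iff_ne_zero.2 hε))).exists
  refine ⟨N, ?_⟩
  rwa [← lintegral_indicator Metric.isClosed_closedBall.measurableSet.compl]

/-- `L_φ` is in `S` for a test function `φ`: the common integrable bound on the functions `φ^∨(·, r)` makes
truncation in `(x, y)` uniform in `r`, and the truncated symbol is continuous of compact support. -/
theorem IsReg.mem_algS {J : Matrix (Fin n) (Fin n) ℝ} {φ : X n → ℂ} (hs : ContDiff ℝ ∞ φ)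
    (hc : HasCompactSupport φ) {T : L2 (X n) →L[ℂ] L2 (X n)} (h : IsReg J φ T) : T ∈ algS J := by
  have hT : IsTw J (pft φ) T := h
  have hp := continuous_pft hs.continuous hc
  refine hT.mem_of_forall_exists hp.measurable (isClosed_algS J) fun ε hε => ?_
  obtain ⟨D, mD, hD, hle⟩ := exists_integrable_bound_pft hs hc
  obtain ⟨N, hN⟩ := exists_setLIntegral_compl_closedBall_le mD hD
    (ε := ENNReal.ofReal ε) (by simpa using hε)
  obtain ⟨χ, hχ1, -, hχc, hχ01⟩ := exists_continuous_one_zero_of_isCompact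
    (isCompact_closedBall (0 : V n × V n) N) isClosed_empty (Set.disjoint_empty _)
  let g : X n → ℂ := fun u => (χ (u.1, u.2.1) : ℂ) * pft φ (u.1, u.2.1) u.2.2
  have hg : Continuous g := by
    refine Continuous.mul (by have := χ.continuous; fun_prop) ?_
    exact hp.comp (f := fun u : X n => ((u.1, u.2.1), u.2.2)) (by fun_prop)
  have hgc : HasCompactSupport g := by
    refine HasCompactSupport.intro ((hχc.isCompact.prod
      (hc.isCompact.image (f := fun u : X n => u.2.2) (by fun_prop))).image
      (f := fun p : (V n × V n) × ℝ => ((p.1.1, p.1.2, p.2) : X n)) (by fun_prop)) fun u hu => ?_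
    by_cases h1 : ((u.1, u.2.1) : V n × V n) ∈ tsupport χ
    · by_cases h2 : u.2.2 ∈ (fun u : X n => u.2.2) '' tsupport φ
      · exact absurd ⟨(_, _), ⟨h1, h2⟩, rfl⟩ hu
      · have : ∀ k : V n × V n, φ (k.1, k.2, u.2.2) = 0 := fun k =>
          image_eq_zero_of_notMem_tsupport (f := φ) fun h => h2 ⟨_, h, rfl⟩
        simp [g, pft, this]
    · simp [g, image_eq_zero_of_notMem_tsupport h1]
  obtain ⟨T', hT'⟩ := exists_isTw_symb J hg hgc
  refine ⟨symb g, T', hT', (continuous_symb hg).measurable, hT'.mem_algS hg hgc, fun r => ?_⟩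
  refine le_trans ?_ hN
  rw [← lintegral_indicator Metric.isClosed_closedBall.measurableSet.compl]
  refine lintegral_mono_ae ?_
  filter_upwards [hle] with w hw
  have e : pft φ w r - symb g w r = ((1 - χ w : ℝ) : ℂ) * pft φ w r := by
    simp only [symb, g]
    push_cast
    ring
  by_cases hwN : w ∈ Metric.closedBall (0 : V n × V n) N
  · rw [e, hχ1 hwN]
    simp
  · rw [Set.indicator_of_mem hwN, e, enorm_mul]
    refine le_trans (mul_le_of_le_one_left' ?_) (hw r)
    rw [← ofReal_norm, Complex.norm_real, Real.norm_of_nonneg (by linarith [(hχ01 w).2])]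
    exact ENNReal.ofReal_le_one.2 (by linarith [(hχ01 w).1])

end HeisenbergQG

end

theorem mainTheorem5 (n : ℕ) (hn : 2 ≤ n) (J : Matrix (Fin n) (Fin n) ℝ) (hJ : J.transpose = -J) :
    (∀ φ : X n → ℂ, ContDiff ℝ ∞ φ → HasCompactSupport φ →
      ∃ T, IsReg J φ T) ∧
    (algS J : Set (L2 (X n) →L[ℂ]
        L2 (X n))) =
      closure {T | ∃ φ : X n → ℂ, ContDiff ℝ ∞ φ ∧ HasCompactSupport φ ∧
        IsReg J φ T} ∧
    ∀ φ : X n → ℂ, Continuous φ → HasCompactSupport φ →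
      (Continuous (comulFun J φ) ∧ ∃ C : ℝ, ∀ z, ‖comulFun J φ z‖ ≤ C) ∧
      (∀ T, IsReg J φ T →
        ∀ B, IsRegTensor J (comulFun J φ) B ↔
          B = comul J T) ∧
      (∀ ζ : X n × X n → ℂ, ContDiff ℝ ∞ ζ → HasCompactSupport ζ →
        ∀ κ : L2 (X n × X n), κ =ᵐ[volume] ζ →
          ∃ η, IsRegAmp J φ ((VTheta J).symm κ) η ∧
            IsRegTensorAt J (comulFun J φ) ζ
              (VTheta J η)) := by
  refine ⟨fun φ hs hc => exists_isReg J hs hc, ?_, fun φ hφ hφc => ⟨⟨?_, ?_⟩, ?_, ?_⟩⟩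
  · refine Set.Subset.antisymm (algS_le_closure J) (closure_minimal ?_ (isClosed_algS J))
    rintro T ⟨φ, hs, hc, h⟩
    exact h.mem_algS hs hc
  · exact continuous_comulFun J hφ
  · obtain ⟨C, hC⟩ := hφ.bounded_above_of_compact_support hφc
    exact ⟨C, fun z => hC _⟩
  · intro T hT B
    have h := isRegTensor_comul hJ hφ hφc hT
    exact ⟨fun hB => hB.unique h, fun hB => hB ▸ h⟩
  · intro ζ hζ hζc κ hκ
    exact exists_isRegAmp_and_isRegTensorAt hJ hφ hφc hζ hζc hκ
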